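/- Let $d\ge 1$, $S=\mathbb R/\mathbb Z$ with its arc-length metric $d_S$, and $\lambda>0$. Let $\{P_x : x\in\mathbb Z^d\setminus\{0\}\}$ be substochastic kernels on $S$ such that $Q=\sum_{x\ne 0}P_x$ is a stochastic kernel. Let $\xi_t=(\eta_t,\varepsilon_t)$, $t\ge 0$, be a continuous time random walk with internal states: a time-homogeneous pure jump Markov process on $\mathbb Z^d\times S$, with an arbitrary initial distribution, which from the state $(x,v)$ stays put during a time $dt$ with probability $1-\lambda\,dt+o(dt)$ and moves to $\{x+y\}\times A$ with probability $\lambda P_y(v,A)\,dt+o(dt)$, for every $y\neq 0$ and every measurable $A\subseteq S$. Write $P_xf(v)=\int_S f(v')\,P_x(v,dv')$, $M_l=\sum_x x_lP_x$, $\Sigma_{lm}=\sum_x x_lx_mP_x$ $(1\le l,m\le d)$, and $(\mu,f)=\int_S f\,d\mu$. Let $L_\infty(S)$ be the Banach space of bounded measurable functions on $S$ with the supremum norm. Assume: 1. (Moments) for every $k\ge 0$, $\sup_{u\in S}\sum_{x}|x|^k P_x(u,S)<\infty$ (this holds in particular if the jumps have bounded range); 2. (Spectral gap) $1$ is a simple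 eigenvalue of $Q:L_\infty(S)\to L_\infty(S)$, and the rest of the spectrum of $Q$ lies in a disc $|z|\le\delta$ with $\delta<1$; $\rho$ denotes the stationary probability measure, $\rho Q=\rho$; 3. (No drift) $(\rho,M_l\mathbf 1)=0$ for $1\le l\le d$; 4. (Nonsingularity) the matrix $\sigma=(\sigma_{lm})_{1\le l,m\le d}$, $$\sigma_{lm}=(\rho,\Sigma_{lm}\mathbf 1)-(\rho,M_l(Q-I)^{-1}M_m\mathbf 1)-(\rho,M_m(Q-I)^{-1}M_l\mathbf 1),$$ is positive definite, where $(Q-I)^{-1}$ is the inverse of $Q-I$ on the functions in $L_\infty(S)$ with $\rho$-mean zero. Then, as $t\to\infty$, $$\Bigl(\frac{\eta_t}{\sqrt t},\varepsilon_t\Bigr)\Rightarrow \mathcal N^d(0,\lambda\sigma)\times\rho$$ weakly in $\mathbb R^d\times S$, endowed with the sum of the Euclidean metric and $d_S$. -/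

import Mathlib

open MeasureTheory ProbabilityTheory Filter Topology Asymptotics
open scoped NNReal ENNReal

/-! ### The Banach space of bounded measurable functions and the operator of a Markov kernel -/

/-- The Banach space `L_∞(S)` of bounded measurable functions `S → ℂ` (functions, not classes)
with the supremum norm, as a subspace of the space of all bounded functions. -/
def BddMeas (S : Type*) [MeasurableSpace S] : Submodule ℂ (lp (fun _ : S => ℂ) ∞) where
  carrier := {f | Measurable (fun u : S => f u)}
  add_mem' := by
    intro f g hf hg
    exact Measurable.add (f := fun u : S => f u) (g := fun u : S => g u) hf hg
  zero_mem' := measurable_const (a := (0 : ℂ))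
  smul_mem' := by
    intro c f hf
    exact Measurable.const_smul (g := fun u : S => f u) hf c

lemma BddMeas.norm_le {S : Type*} [MeasurableSpace S] (f : BddMeas S) (u : S) :
    ‖(f : lp (fun _ : S => ℂ) ∞) u‖ ≤ ‖f‖ :=
  lp.norm_apply_le_norm ENNReal.top_ne_zero (f : lp (fun _ : S => ℂ) ∞) u

lemma BddMeas.integrable {S : Type*} [MeasurableSpace S] (f : BddMeas S) (μ : Measure S)
    [IsFiniteMeasure μ] : Integrable (fun v : S => (f : lp (fun _ : S => ℂ) ∞) v) μ :=
  Integrable.of_bound (Measurable.aestronglyMeasurable f.2) ‖f‖ (ae_of_all _ (BddMeas.norm_le f))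

lemma BddMeas.norm_integral_le {S : Type*} [MeasurableSpace S] (f : BddMeas S) (μ : Measure S)
    [IsProbabilityMeasure μ] : ‖∫ v, (f : lp (fun _ : S => ℂ) ∞) v ∂μ‖ ≤ ‖f‖ := by
  simpa using norm_integral_le_of_norm_le_const (μ := μ) (ae_of_all _ (BddMeas.norm_le f))

/-- The operator `(Q f)(u) = ∫ f(v) Q(u, dv)` of a Markov kernel on bounded measurable functions,
as a bounded linear operator. -/
noncomputable def kernelOp {S : Type*} [MeasurableSpace S] (Q : Kernel S S) [IsMarkovKernel Q] :
    BddMeas S →L[ℂ] BddMeas S :=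
  LinearMap.mkContinuous
    { toFun := fun f =>
        ⟨⟨fun u => ∫ v, (f : lp (fun _ : S => ℂ) ∞) v ∂(Q u), memℓp_infty ⟨‖f‖, by
            rintro _ ⟨u, rfl⟩
            exact BddMeas.norm_integral_le f (Q u)⟩⟩,
          (StronglyMeasurable.integral_kernel (κ := Q)
            (f := fun v : S => (f : lp (fun _ : S => ℂ) ∞) v)
            (Measurable.stronglyMeasurable f.2)).measurable⟩
      map_add' := by
        intro f g
        apply Subtype.ext
        apply lp.ext
        funext u
        exact integral_add (BddMeas.integrable f (Q u)) (BddMeas.integrable g (Q u))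
      map_smul' := by
        intro c f
        apply Subtype.ext
        apply lp.ext
        funext u
        exact integral_smul c (fun v : S => (f : lp (fun _ : S => ℂ) ∞) v) }
    1 (by
      intro f
      rw [one_mul]
      exact lp.norm_le_of_forall_le (norm_nonneg f) (fun u => BddMeas.norm_integral_le f (Q u)))

/-- Spectral gap of a Markov kernel on the space of bounded measurable functions: `1` is a simple
eigenvalue and the rest of the spectrum lies in a disc `|z| ≤ δ` with `δ < 1`. The eigenvalue is
geometrically simple by `finrank_ker` and has no further algebraic multiplicity by
`isCompl`; for an isolated point of the spectrum the two together say exactly that the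
Riesz spectral projection at `1` has rank one. -/
structure HasSpectralGap {S : Type*} [MeasurableSpace S] (Q : Kernel S S) [IsMarkovKernel Q] :
    Prop where
  finrank_ker : Module.finrank ℂ ((kernelOp Q - 1 : BddMeas S →L[ℂ] BddMeas S).ker) = 1
  isCompl : IsCompl ((kernelOp Q - 1 : BddMeas S →L[ℂ] BddMeas S).ker)
    ((kernelOp Q - 1 : BddMeas S →L[ℂ] BddMeas S).range)
  gap : ∃ δ : ℝ, δ < 1 ∧ ∀ z ∈ spectrum ℂ (kernelOp Q), z = 1 ∨ ‖z‖ ≤ δ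

/-! ### Moment operators and the asymptotic covariance matrix -/

/-- All moments of the jumps are finite, as bounded operators: for every `k` the `k`-th absolute
moment of the jump is bounded uniformly in the internal state. (`‖x‖` is the maximum norm on
`ℤ^d`; any other norm gives the same condition.) -/
def HasFiniteMoments {d : ℕ} {S : Type*} [MeasurableSpace S] (P : (Fin d → ℤ) → Kernel S S) :
    Prop :=
  ∀ k : ℕ, ∃ C : ℝ≥0, ∀ u : S, ∑' x : Fin d → ℤ, (‖x‖₊ : ℝ≥0∞) ^ k * P x u Set.univ ≤ C

/-- The operator `M_l = ∑_x x_l P_x`. -/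
noncomputable def momentOne {d : ℕ} {S : Type*} [MeasurableSpace S]
    (P : (Fin d → ℤ) → Kernel S S) (l : Fin d) (f : S → ℝ) (u : S) : ℝ :=
  ∑' x : Fin d → ℤ, (x l : ℝ) * ∫ v, f v ∂(P x u)

/-- The operator `Σ_{l,m} = ∑_x x_l x_m P_x`. -/
noncomputable def momentTwo {d : ℕ} {S : Type*} [MeasurableSpace S]
    (P : (Fin d → ℤ) → Kernel S S) (l m : Fin d) (f : S → ℝ) (u : S) : ℝ :=
  ∑' x : Fin d → ℤ, (x l : ℝ) * (x m : ℝ) * ∫ v, f v ∂(P x u)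

/-- `f` is a bounded measurable function with `(ρ, f) = 0` and `(Q - I) f = g`. -/
structure IsCenteredSolution {S : Type*} [MeasurableSpace S] (Q : Kernel S S) (ρ : Measure S)
    (g f : S → ℝ) : Prop where
  measurable : Measurable f
  bounded : ∃ C : ℝ, ∀ u, |f u| ≤ C
  centered : ∫ u, f u ∂ρ = 0
  solves : ∀ u, ∫ v, f v ∂(Q u) - f u = g u

open Classical in
/-- The function `(Q - I)⁻¹ g`, where `Q - I` is inverted on the space of bounded measurable
functions with `ρ`-mean zero. Under a spectral gap and `(ρ, g) = 0` there is exactly one such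
function; the value is `0` if there is none. -/
noncomputable def invSubOne {S : Type*} [MeasurableSpace S] (Q : Kernel S S) (ρ : Measure S)
    (g : S → ℝ) : S → ℝ :=
  if h : ∃ f, IsCenteredSolution Q ρ g f then h.choose else 0

/-- The asymptotic covariance matrix
`σ_{lm} = (ρ, Σ_{lm} 1) - (ρ, M_l (Q - I)⁻¹ M_m 1) - (ρ, M_m (Q - I)⁻¹ M_l 1)`,
with `Q = ∑_x P_x`. -/
noncomputable def asymptoticCov {d : ℕ} {S : Type*} [MeasurableSpace S]
    (P : (Fin d → ℤ) → Kernel S S) (ρ : Measure S) : Matrix (Fin d) (Fin d) ℝ :=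
  Matrix.of fun l m =>
    ∫ u, momentTwo P l m (fun _ => 1) u ∂ρ
      - ∫ u, momentOne P l (invSubOne (Kernel.sum P) ρ (momentOne P m (fun _ => 1))) u ∂ρ
      - ∫ u, momentOne P m (invSubOne (Kernel.sum P) ρ (momentOne P l (fun _ => 1))) u ∂ρ

/-! ### Continuous time random walks with internal states -/

/-- A time-homogeneous Markov transition function on `E`: Markov kernels `p t` with `p 0 = id`
and the Chapman-Kolmogorov equations. -/
structure IsTransitionFunction {E : Type*} [MeasurableSpace E] (p : ℝ≥0 → Kernel E E) :
    Prop where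
  isMarkovKernel : ∀ t, IsMarkovKernel (p t)
  zero : p 0 = Kernel.id
  add : ∀ s t, p (s + t) = p t ∘ₖ p s

/-- `ξ` is a Markov process under `μ` with transition function `p`: given the past up to time `s`,
the law of `ξ_{s+t}` is `p t (ξ_s, ·)`. The initial distribution is arbitrary. -/
structure IsMarkovProcess {Ω E : Type*} [MeasurableSpace Ω] [MeasurableSpace E]
    (p : ℝ≥0 → Kernel E E) (ξ : ℝ≥0 → Ω → E) (μ : Measure Ω) : Prop where
  measurable : ∀ t, Measurable (ξ t)
  markov : ∀ (s t : ℝ≥0) (B : Set E), MeasurableSet B →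
    μ[(ξ (s + t) ⁻¹' B).indicator (fun _ => (1 : ℝ)) |
        ⨆ r : Set.Iic s, MeasurableSpace.comap (ξ r) inferInstance]
      =ᵐ[μ] fun ω => (p t (ξ s ω)).real B

/-- The infinitesimal description of a random walk with internal states: from `(x, v)`, during a
short time `h`, the walk stays put with probability `1 - λ h + o(h)`, and for every displacement
`y ≠ 0` it moves to `{x + y} × A` with probability `λ P_y(v, A) h + o(h)`. -/
structure HasJumpRates {d : ℕ} {S : Type*} [MeasurableSpace S] (lam : ℝ)
    (P : (Fin d → ℤ) → Kernel S S)
    (p : ℝ≥0 → Kernel ((Fin d → ℤ) × S) ((Fin d → ℤ) × S)) : Prop where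
  stay : ∀ z : (Fin d → ℤ) × S,
    (fun h : ℝ≥0 => (p h z).real {z} - (1 - lam * h)) =o[𝓝[>] 0] (fun h : ℝ≥0 => (h : ℝ))
  jump : ∀ (x y : Fin d → ℤ) (v : S) (A : Set S), y ≠ 0 → MeasurableSet A →
    (fun h : ℝ≥0 => (p h (x, v)).real ({x + y} ×ˢ A) - lam * (P y v).real A * h)
      =o[𝓝[>] 0] (fun h : ℝ≥0 => (h : ℝ))

/-- `ξ = (η, ε)` is a continuous time random walk on `ℤ^d` with internal states in `S`, jump rate
`lam` and jump kernels `P`: a pure jump Markov process with the above infinitesimal description.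
Pure jump: almost every path is locally constant to the right of every time and to the left of
every time, i.e. a right continuous step function with finitely many jumps in every bounded time
interval. -/
def IsRWwIS {d : ℕ} {S Ω : Type*} [MeasurableSpace S] [MeasurableSpace Ω] (lam : ℝ)
    (P : (Fin d → ℤ) → Kernel S S) (ξ : ℝ≥0 → Ω → (Fin d → ℤ) × S) (μ : Measure Ω) : Prop :=
  (∃ p : ℝ≥0 → Kernel ((Fin d → ℤ) × S) ((Fin d → ℤ) × S),
    IsTransitionFunction p ∧ HasJumpRates lam P p ∧ IsMarkovProcess p ξ μ) ∧
  ∀ᵐ ω ∂μ, ∀ t : ℝ≥0, (∀ᶠ s in 𝓝[>] t, ξ s ω = ξ t ω) ∧ ∃ z, ∀ᶠ s in 𝓝[<] t, ξ s ω = z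

/-- The rescaled pair `(η_t / √t, ε_t)` in `ℝ^d × S`. -/
noncomputable def rescaled {d : ℕ} {S Ω : Type*} (ξ : ℝ≥0 → Ω → (Fin d → ℤ) × S) (t : ℝ≥0)
    (ω : Ω) : EuclideanSpace ℝ (Fin d) × S :=
  (WithLp.toLp 2 fun i => ((ξ t ω).1 i : ℝ) / √(t : ℝ), (ξ t ω).2)

/-! ### Exponentials of generators `λ (T - 1)` with `T` a contraction -/

/-! Let `T` be the operator of one step of the walk on bounded measurable functions on ℤ^d × S (the
operator of `stepKernel`). The infinitesimal description forces the semigroup of the walk to be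
exp(tλ(T - 1)) (`HasJumpKernel.kernelOp_eq_exp`). With ε = 1/√t, the expectation of exp(i⟨θ,
η_t⟩/√t) g(ε_t) is therefore this semigroup applied to the plane wave exp(iε⟨θ, x⟩) g(v), integrated
over the initial law. Its limit comes from sup-norm estimates for contractions, without perturbation
theory of the spectrum. Split g into its mean (ρ, g) and a centred part.

The centred part is Qh - h for some h; this solvability is how the spectral gap enters. Since ε is
small, its plane wave is (T - 1) applied to the plane wave of h, up to O(ε). The semigroup forgets
the range of T - 1: exp(τ(T - 1))(T - 1) is a Poisson average of powers of T with weights N/τ - 1,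
so its norm is at most 1/√τ (`norm_exp_smul_sub_one_mul_sub_one_le`).

For the constant amplitude 1, `exists_correctors` provides a and b, solutions of Poisson equations,
such that the plane wave with amplitude 1 + iεa + ε²b is an eigenfunction of T with eigenvalue 1 -
ε²⟨θ, σθ⟩/2, up to O(ε³) (`exists_approximate_eigenfunction`). The matrix σ appears as the mean that
must be removed to make the second equation solvable. Over the time t = ε⁻² the error adds up to
O(ε), while the eigenvalue produces exp(-λ⟨θ, σθ⟩/2), the Gaussian characteristic function
(`exists_norm_stepSemigroup_planeWave_one_sub_le`).

These limits give weak convergence because the circle is closed in ℂ, so Lévy's theorem on a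
Euclidean space applies (`tendsto_of_tendsto_integral_exp_mul`). -/

lemma HasSum.of_eq {ι M : Type*} [AddCommMonoid M] [TopologicalSpace M] {f g : ι → M} {a b : M}
    (h : HasSum f a) (hf : ∀ i, g i = f i) (hb : b = a) : HasSum g b := by
  rwa [hb, funext hf]

/-! ### Moments of the Poisson distribution -/

lemma hasSum_pow_div_factorial (τ : ℝ) :
    HasSum (fun n : ℕ => τ ^ n / (n.factorial : ℝ)) (Real.exp τ) := by
  rw [Real.exp_eq_exp_ℝ]
  exact NormedSpace.expSeries_div_hasSum_exp τ

lemma hasSum_nat_mul_pow_div_factorial (τ : ℝ) :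
    HasSum (fun n : ℕ => (n : ℝ) * (τ ^ n / (n.factorial : ℝ))) (τ * Real.exp τ) := by
  rw [← hasSum_nat_add_iff' 1]
  refine ((hasSum_pow_div_factorial τ).mul_left τ).of_eq (fun n => ?_) ?_
  · rw [Nat.factorial_succ]
    push_cast
    field_simp
    ring
  · simp

lemma hasSum_nat_sq_mul_pow_div_factorial (τ : ℝ) :
    HasSum (fun n : ℕ => (n : ℝ) ^ 2 * (τ ^ n / (n.factorial : ℝ)))
      (τ * (τ * Real.exp τ + Real.exp τ)) := by
  rw [← hasSum_nat_add_iff' 1]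
  refine (((hasSum_nat_mul_pow_div_factorial τ).add (hasSum_pow_div_factorial τ)).mul_left τ).of_eq (fun n => ?_) ?_
  · rw [Nat.factorial_succ]
    push_cast
    field_simp
    ring
  · simp

/-- The mean absolute deviation of a normalized Poisson variable is at most its standard
deviation. -/
lemma hasSum_poisson_abs_dev {τ : ℝ} (hτ : 0 < τ) :
    ∃ s ≤ 1 / √τ, HasSum
      (fun n : ℕ => Real.exp (-τ) * (τ ^ n / (n.factorial : ℝ)) * |(n : ℝ) / τ - 1|) s := by
  have hE : Real.exp (-τ) * Real.exp τ = 1 := by rw [← Real.exp_add]; simp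
  -- The majorant is the AM-GM bound |x| ≤ 1/(2√τ) + √τ x²/2 at x = n/τ - 1. As N/τ has variance
  -- 1/τ, each half contributes 1/(2√τ).
  have h2 : HasSum (fun n : ℕ => Real.exp (-τ) * (τ ^ n / (n.factorial : ℝ)) *
      (1 / √τ / 2 + √τ / 2 * ((n : ℝ) / τ - 1) ^ 2)) (1 / √τ) := by
    have h := (((hasSum_nat_sq_mul_pow_div_factorial τ).mul_left (√τ / (2 * τ ^ 2))).add
      (((hasSum_nat_mul_pow_div_factorial τ).mul_left (-√τ / τ)).add
      ((hasSum_pow_div_factorial τ).mul_left (1 / √τ / 2 + √τ / 2)))).mul_left (Real.exp (-τ))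
    refine h.of_eq (fun n => ?_) ?_
    · field_simp
      ring
    · have h3 : √τ * √τ = τ := Real.mul_self_sqrt hτ.le
      have h4 : √τ ≠ 0 := by positivity
      have : Real.exp (-τ) * (√τ / (2 * τ ^ 2) * (τ * (τ * Real.exp τ + Real.exp τ)) +
          (-√τ / τ * (τ * Real.exp τ) + (1 / √τ / 2 + √τ / 2) * Real.exp τ)) =
          (Real.exp (-τ) * Real.exp τ) * (√τ / (2 * τ) + 1 / √τ / 2) := by
        field_simp
        ring
      rw [this, hE]
      field_simp
      nlinarith
  have hle : ∀ n : ℕ, Real.exp (-τ) * (τ ^ n / (n.factorial : ℝ)) * |(n : ℝ) / τ - 1| ≤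
      Real.exp (-τ) * (τ ^ n / (n.factorial : ℝ)) *
      (1 / √τ / 2 + √τ / 2 * ((n : ℝ) / τ - 1) ^ 2) := by
    intro n
    gcongr
    rw [← sq_abs]
    have h4 : 0 < √τ := by positivity
    have := sq_nonneg (√τ * |(n : ℝ) / τ - 1| - 1)
    rw [show 1 / √τ / 2 + √τ / 2 * |(n : ℝ) / τ - 1| ^ 2 =
      |(n : ℝ) / τ - 1| + (√τ * |(n : ℝ) / τ - 1| - 1) ^ 2 / (2 * √τ) by field_simp; ring]
    have : 0 ≤ (√τ * |(n : ℝ) / τ - 1| - 1) ^ 2 / (2 * √τ) := by positivity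
    linarith
  have hs := Summable.of_nonneg_of_le (fun n => by positivity) hle h2.summable
  exact ⟨_, hasSum_le hle hs.hasSum h2, hs.hasSum⟩

lemma norm_pow_le_one_of_norm_le_one {𝔸 : Type*} [NormedRing 𝔸] [NormOneClass 𝔸] {T : 𝔸} (hT : ‖T‖ ≤ 1) (n : ℕ) : ‖T ^ n‖ ≤ 1 :=
  (norm_pow_le T n).trans (pow_le_one₀ (norm_nonneg T) hT)

section Contraction

variable {𝔸 : Type*} [NormedRing 𝔸] [NormedAlgebra ℝ 𝔸] [CompleteSpace 𝔸]

/-- The Poisson series of the semigroup generated by `T - 1`. -/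
lemma hasSum_exp_smul_sub_one (T : 𝔸) (τ : ℝ) :
    HasSum (fun n : ℕ => (Real.exp (-τ) * (τ ^ n / (n.factorial : ℝ))) • T ^ n)
      (NormedSpace.exp (τ • (T - 1))) := by
  let _ : NormedAlgebra ℚ 𝔸 := NormedAlgebra.restrictScalars ℚ ℝ 𝔸
  have h1 : NormedSpace.exp (τ • (T - 1)) = Real.exp (-τ) • NormedSpace.exp (τ • T) := by
    have hc : Commute (τ • T) (algebraMap ℝ 𝔸 (-τ)) := (Algebra.commutes (-τ) (τ • T)).symm
    have : τ • (T - 1) = τ • T + algebraMap ℝ 𝔸 (-τ) := by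
      rw [smul_sub, Algebra.algebraMap_eq_smul_one, neg_smul, sub_eq_add_neg]
    rw [this, NormedSpace.exp_add_of_commute hc, ← NormedSpace.algebraMap_exp_comm,
      ← Real.exp_eq_exp_ℝ, ← Algebra.commutes, ← Algebra.smul_def]
  rw [h1]
  refine ((NormedSpace.exp_series_hasSum_exp' (𝕂 := ℝ) (τ • T)).const_smul
    (Real.exp (-τ))).of_eq (fun n => ?_) rfl
  rw [smul_pow, smul_smul, smul_smul]
  congr 1
  field_simp

/-- The Poisson series is a convex combination of powers of the contraction `T`. -/
lemma norm_exp_smul_sub_one_le [NormOneClass 𝔸] {T : 𝔸} (hT : ‖T‖ ≤ 1) {τ : ℝ} (hτ : 0 ≤ τ) :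
    ‖NormedSpace.exp (τ • (T - 1))‖ ≤ 1 := by
  have h1 := (hasSum_pow_div_factorial τ).mul_left (Real.exp (-τ))
  rw [← Real.exp_add, neg_add_cancel, Real.exp_zero] at h1
  rw [← (hasSum_exp_smul_sub_one T τ).tsum_eq]
  refine tsum_of_norm_bounded h1 fun n => ?_
  rw [norm_smul, Real.norm_of_nonneg (by positivity)]
  exact mul_le_of_le_one_right (by positivity) (norm_pow_le_one_of_norm_le_one hT n)

/-- The semigroup generated by `T - 1`, with `T` a contraction, smooths: the norm of its
derivative decays. -/
lemma norm_exp_smul_sub_one_mul_sub_one_le [NormOneClass 𝔸] {T : 𝔸} (hT : ‖T‖ ≤ 1) {τ : ℝ} (hτ : 0 < τ) :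
    ‖NormedSpace.exp (τ • (T - 1)) * (T - 1)‖ ≤ 1 / √τ := by
  obtain ⟨s, hs, hsum⟩ := hasSum_poisson_abs_dev hτ
  set c : ℕ → ℝ := fun n => Real.exp (-τ) * (τ ^ n / (n.factorial : ℝ)) with hc
  have hE := hasSum_exp_smul_sub_one T τ
  -- Multiplication by `T` shifts the Poisson weights, and c (n + 1) * (n + 1) / τ = c n.
  -- Subtracting the unshifted series leaves the weights c n * (n/τ - 1), whose absolute sum is the
  -- mean absolute deviation.
  have h1 : HasSum (fun n : ℕ => (c n * (n / τ)) • T ^ n)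
      (NormedSpace.exp (τ • (T - 1)) * T) := by
    rw [← hasSum_nat_add_iff' 1]
    simp only [Finset.range_one, Finset.sum_singleton, Nat.cast_zero, zero_div, mul_zero, zero_smul,
      sub_zero]
    refine (hE.mul_right T).of_eq (fun n => ?_) rfl
    rw [smul_mul_assoc, pow_succ]
    congr 1
    simp only [hc, Nat.factorial_succ]
    push_cast
    field_simp
    ring
  have h2 : HasSum (fun n : ℕ => (c n * ((n : ℝ) / τ - 1)) • T ^ n)
      (NormedSpace.exp (τ • (T - 1)) * (T - 1)) := by
    rw [mul_sub, mul_one]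
    refine (h1.sub hE).of_eq (fun n => ?_) rfl
    rw [← sub_smul]
    congr 1
    ring
  rw [← h2.tsum_eq]
  refine (tsum_of_norm_bounded hsum fun n => ?_).trans hs
  rw [norm_smul, norm_mul, Real.norm_of_nonneg (by positivity : 0 ≤ c n), Real.norm_eq_abs]
  exact mul_le_of_le_one_right (by positivity) (norm_pow_le_one_of_norm_le_one hT n)

end Contraction

/-! ### Comparison of evolutions with exponentials of a generator -/

/-- An approximate eigenvector of the generator of a contraction semigroup evolves approximately
like an eigenvector. -/
lemma norm_exp_smul_apply_sub_le {B : Type*} [NormedAddCommGroup B] [NormedSpace ℂ B]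
    [CompleteSpace B] {A : B →L[ℂ] B} (hA : ∀ t : ℝ, 0 ≤ t → ‖NormedSpace.exp (t • A)‖ ≤ 1)
    {κ : ℝ} (hκ : κ ≤ 0) (F : B) {t : ℝ} (ht : 0 ≤ t) :
    ‖NormedSpace.exp (t • A) F - Real.exp (t * κ) • F‖ ≤ ‖A F - κ • F‖ * t := by
  -- Duhamel interpolation: `f 0` is the scalar evolution and `f t` the semigroup. The derivative is
  -- a contraction applied to the defect `A F - κ • F`.
  let f : ℝ → B := fun s => Real.exp ((t - s) * κ) • NormedSpace.exp (s • A) F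
  have hd : ∀ s : ℝ, HasDerivAt f
      (Real.exp ((t - s) * κ) • NormedSpace.exp (s • A) (A F - κ • F)) s := by
    intro s
    have h1 : HasDerivAt (fun s : ℝ => NormedSpace.exp (s • A) F)
        ((NormedSpace.exp (s • A) * A) F) s :=
      ((ContinuousLinearMap.apply ℂ B F).restrictScalars ℝ).hasFDerivAt.comp_hasDerivAt s
        (hasDerivAt_exp_smul_const (𝕂 := ℝ) A s)
    have h2 : HasDerivAt (fun s : ℝ => Real.exp ((t - s) * κ))
        (Real.exp ((t - s) * κ) * (-1 * κ)) s :=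
      ((((hasDerivAt_id s).const_sub t).mul_const κ).exp)
    refine (h2.smul h1).congr_deriv ?_
    have hk : NormedSpace.exp (s • A) (κ • F) = κ • NormedSpace.exp (s • A) F := by
      rw [← Complex.coe_smul κ F, map_smul, Complex.coe_smul]
    rw [mul_apply_eq_comp, map_sub, hk]
    module
  have := norm_image_sub_le_of_norm_deriv_right_le_segment (f := f) (a := 0) (b := t)
    (C := ‖A F - κ • F‖)
    (fun s _ => (hd s).continuousAt.continuousWithinAt) (fun s _ => (hd s).hasDerivWithinAt)
    (fun s hs => ?_) t ⟨ht, le_rfl⟩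
  · simpa [f] using this
  · rw [norm_smul, Real.norm_of_nonneg (Real.exp_pos _).le]
    calc _ ≤ 1 * (1 * ‖A F - κ • F‖) := by
          gcongr
          · exact Real.exp_le_one_iff.2 (mul_nonpos_of_nonneg_of_nonpos (sub_nonneg.2 hs.2.le) hκ)
          · exact (ContinuousLinearMap.le_opNorm _ _).trans (by gcongr; exact hA s hs.1)
      _ = _ := by simp

/-- A contraction-valued function of time whose right derivatives, tested against a separating
family of functionals, are those of the semigroup generated by `G` is that semigroup. -/
lemma eq_exp_smul_of_hasDerivWithinAt {B ι : Type*} [NormedAddCommGroup B] [NormedSpace ℂ B]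
    [CompleteSpace B] {U : ℝ → B →L[ℂ] B} {G : B →L[ℂ] B} {φ : ι → B →L[ℂ] ℂ}
    (hφ : ∀ i F, ‖φ i F‖ ≤ ‖F‖) (hsep : ∀ F, (∀ i, φ i F = 0) → F = 0)
    (h0 : U 0 = 1) (hU : ∀ s, ‖U s‖ ≤ 1)
    (hcont : ∀ i F, ContinuousOn (fun s => φ i (U s F)) (Set.Ici 0))
    (hderiv : ∀ i F (s : ℝ), 0 ≤ s →
      HasDerivWithinAt (fun s => φ i (U s F)) (φ i (U s (G F))) (Set.Ici s) s)
    {t : ℝ} (ht : 0 ≤ t) : U t = NormedSpace.exp (t • G) := by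
  let W : ℝ → B →L[ℂ] B := fun s => NormedSpace.exp (s • G)
  obtain ⟨M, hM⟩ : ∃ M, ∀ s ∈ Set.Icc (0 : ℝ) t, ‖W s‖ ≤ M := by
    have hc : Continuous W := continuous_iff_continuousAt.2 fun s =>
      (hasDerivAt_exp_smul_const (𝕂 := ℝ) G s).continuousAt
    exact isCompact_Icc.exists_bound_of_continuousOn hc.continuousOn
  have hWd : ∀ i F (s : ℝ), HasDerivAt (fun s => φ i (W s F)) (φ i (W s (G F))) s := by
    intro i F s
    exact (((φ i).comp (ContinuousLinearMap.apply ℂ _ F)).restrictScalars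
      ℝ).hasFDerivAt.comp_hasDerivAt s (hasDerivAt_exp_smul_const (𝕂 := ℝ) G s)
  have hM0 : 0 ≤ M := (norm_nonneg _).trans (hM 0 ⟨le_rfl, ht⟩)
  -- Derivatives are known only after applying each `φ i`, so the estimate is bootstrapped instead
  -- of applying Grönwall to a norm. The derivative of the difference at `F` is the difference at `G
  -- F`; integrating the bound for `n` gains the factor ‖G‖ s / (n + 1).
  have key : ∀ (n : ℕ) i F (s : ℝ), s ∈ Set.Icc (0 : ℝ) t →
      ‖φ i (U s F) - φ i (W s F)‖ ≤ (1 + M) * ‖F‖ * ((‖G‖ * s) ^ n / n.factorial) := by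
    intro n
    induction n with
    | zero =>
      intro i F s hs
      have h1 : ‖φ i (U s F)‖ ≤ 1 * ‖F‖ := (hφ _ _).trans
        (ContinuousLinearMap.le_of_opNorm_le _ (hU s) F)
      have h2 : ‖φ i (W s F)‖ ≤ M * ‖F‖ := (hφ _ _).trans
        (ContinuousLinearMap.le_of_opNorm_le _ (hM s hs) F)
      refine (norm_sub_le _ _).trans ?_
      simp
      linarith
    | succ n ih =>
      intro i F s hs
      refine image_norm_le_of_norm_deriv_right_le_deriv_boundary (a := 0) (b := t)
        (f := fun s : ℝ => φ i (U s F) - φ i (W s F))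
        (f' := fun s : ℝ => φ i (U s (G F)) - φ i (W s (G F)))
        (B := fun s => (1 + M) * ‖F‖ * ((‖G‖ * s) ^ (n + 1) / (n + 1).factorial))
        (B' := fun s => (1 + M) * (‖G‖ * ‖F‖) * ((‖G‖ * s) ^ n / n.factorial)) ?_ ?_ ?_ ?_ ?_ hs
      · exact ((hcont i F).mono fun x hx => hx.1).sub
          (fun x _ => (hWd i F x).continuousAt.continuousWithinAt)
      · intro x hx
        exact (hderiv i F x hx.1).sub (hWd i F x).hasDerivWithinAt
      · simp [W, h0]
      · intro x
        have h := ((((hasDerivAt_id x).const_mul ‖G‖).pow (n + 1)).div_const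
          ((n + 1).factorial : ℝ)).const_mul ((1 + M) * ‖F‖)
        refine h.congr_deriv ?_
        rw [Nat.factorial_succ]
        push_cast
        simp only [id]
        field_simp
      · intro x hx
        refine (ih i (G F) x ⟨hx.1, hx.2.le⟩).trans ?_
        have hx0 := hx.1
        gcongr
        exact G.le_opNorm F
  ext F
  rw [← sub_eq_zero]
  refine hsep _ fun i => ?_
  rw [← norm_le_zero_iff, map_sub]
  have hlim : Tendsto (fun n : ℕ => (1 + M) * ‖F‖ * ((‖G‖ * t) ^ n / n.factorial)) atTop (𝓝 0) := by
    simpa using (FloorSemiring.tendsto_pow_div_factorial_atTop (‖G‖ * t)).const_mul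
      ((1 + M) * ‖F‖)
  exact ge_of_tendsto' hlim fun n => key n i F t ⟨ht, le_rfl⟩

/-! ### The semigroup of a walk with given steps -/

/-- The generator `lam * (T - 1)` of the continuous time walk with steps `T` and rate `lam`. -/
noncomputable def stepGenerator {B : Type*} [NormedAddCommGroup B] [NormedSpace ℂ B]
    (lam : ℝ) (T : B →L[ℂ] B) : B →L[ℂ] B := lam • (T - 1)

/-- The semigroup `exp (t * lam * (T - 1))`. -/
noncomputable def stepSemigroup {B : Type*} [NormedAddCommGroup B] [NormedSpace ℂ B]
    (lam : ℝ) (T : B →L[ℂ] B) (t : ℝ) : B →L[ℂ] B := NormedSpace.exp (t • stepGenerator lam T)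

section StepSemigroup

variable {B : Type*} [NormedAddCommGroup B] [NormedSpace ℂ B] {lam : ℝ} {T : B →L[ℂ] B}

lemma stepGenerator_apply (F : B) : stepGenerator lam T F = lam • (T F - F) := rfl

lemma stepSemigroup_eq (t : ℝ) :
    stepSemigroup lam T t = NormedSpace.exp ((t * lam) • (T - 1)) := by
  rw [stepSemigroup, stepGenerator, smul_smul]

lemma norm_stepSemigroup_le [CompleteSpace B] (hlam : 0 ≤ lam) (hT : ‖T‖ ≤ 1) {t : ℝ}
    (ht : 0 ≤ t) : ‖stepSemigroup lam T t‖ ≤ 1 := by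
  -- The operators on `B` satisfy ‖1‖ = 1 only if `B` is nontrivial.
  rcases subsingleton_or_nontrivial B with h | h
  · rw [Subsingleton.elim (stepSemigroup lam T t) 0, norm_zero]
    exact zero_le_one
  · rw [stepSemigroup_eq]
    exact norm_exp_smul_sub_one_le hT (mul_nonneg ht hlam)

/-- Functions in the range of `T - 1` are forgotten. -/
lemma norm_stepSemigroup_sub_le [CompleteSpace B] (hlam : 0 < lam) (hT : ‖T‖ ≤ 1) {t : ℝ}
    (ht : 0 < t) (F : B) : ‖stepSemigroup lam T t (T F - F)‖ ≤ 1 / √(t * lam) * ‖F‖ := by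
  rcases subsingleton_or_nontrivial B with h | h
  · rw [Subsingleton.elim (stepSemigroup lam T t (T F - F)) 0, norm_zero]
    positivity
  · rw [stepSemigroup_eq]
    exact ContinuousLinearMap.le_of_opNorm_le _
      (norm_exp_smul_sub_one_mul_sub_one_le hT (mul_pos ht hlam)) F

/-- Approximate eigenvectors of `T` evolve approximately like eigenvectors. -/
lemma norm_stepSemigroup_sub_exp_le [CompleteSpace B] (hlam : 0 ≤ lam) (hT : ‖T‖ ≤ 1) {κ : ℝ}
    (hκ : κ ≤ 0) (F : B) {t : ℝ} (ht : 0 ≤ t) :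
    ‖stepSemigroup lam T t F - (Real.exp (t * (lam * κ)) : ℂ) • F‖ ≤
      lam * ‖T F - F - (κ : ℂ) • F‖ * t := by
  rw [Complex.coe_smul, Complex.coe_smul]
  refine (norm_exp_smul_apply_sub_le (A := stepGenerator lam T)
    (fun t ht => norm_stepSemigroup_le hlam hT ht) (mul_nonpos_of_nonneg_of_nonpos hlam hκ) F
    ht).trans (le_of_eq ?_)
  rw [stepGenerator_apply, mul_smul, ← smul_sub, norm_smul, Real.norm_of_nonneg hlam]

end StepSemigroup

/-! ### The space of bounded measurable functions and kernel operators -/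

namespace BddMeas

variable {S : Type*} [MeasurableSpace S]

instance : CoeFun (BddMeas S) (fun _ => S → ℂ) := ⟨fun f => (f : lp (fun _ : S => ℂ) ∞)⟩

/-- A bounded measurable function as an element of the Banach space. -/
def ofBound (f : S → ℂ) (hf : Measurable f) (C : ℝ) (hC : ∀ u, ‖f u‖ ≤ C) : BddMeas S :=
  ⟨⟨f, memℓp_infty ⟨C, by rintro _ ⟨u, rfl⟩; exact hC u⟩⟩, hf⟩

@[simp] lemma ofBound_apply (f : S → ℂ) (hf : Measurable f) (C : ℝ) (hC : ∀ u, ‖f u‖ ≤ C) (u : S) :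
    ofBound f hf C hC u = f u := rfl

@[simp] lemma add_apply (f g : BddMeas S) (u : S) : (f + g) u = f u + g u := rfl
@[simp] lemma sub_apply (f g : BddMeas S) (u : S) : (f - g) u = f u - g u := rfl
@[simp] lemma smul_apply (c : ℂ) (f : BddMeas S) (u : S) : (c • f) u = c * f u := rfl

protected lemma measurable (f : BddMeas S) : Measurable (fun u => f u) := f.2

@[ext] lemma ext {f g : BddMeas S} (h : ∀ u, f u = g u) : f = g :=
  Subtype.ext (lp.ext (funext h))

lemma norm_le_of_forall_le {f : BddMeas S} {C : ℝ} (hC : 0 ≤ C) (h : ∀ u, ‖f u‖ ≤ C) : ‖f‖ ≤ C :=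
  lp.norm_le_of_forall_le hC h

/-- Evaluation at a point as a continuous linear map. -/
noncomputable def evalCLM (u : S) : BddMeas S →L[ℂ] ℂ :=
  LinearMap.mkContinuous
    { toFun := fun f => f u
      map_add' := fun _ _ => rfl
      map_smul' := fun _ _ => rfl } 1 fun f => by rw [one_mul]; exact BddMeas.norm_le f u

@[simp] lemma evalCLM_apply (u : S) (f : BddMeas S) : evalCLM u f = f u := rfl

instance : CompleteSpace (BddMeas S) := by
  have : IsClosed (BddMeas S : Set (lp (fun _ : S => ℂ) ∞)) := by
    refine isClosed_of_closure_subset fun f hf => ?_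
    obtain ⟨x, hx, hlim⟩ := mem_closure_iff_seq_limit.1 hf
    refine measurable_of_tendsto_metrizable (f := fun n (u : S) => x n u) (fun n => hx n) ?_
    rw [tendsto_pi_nhds]
    intro u
    refine tendsto_iff_norm_sub_tendsto_zero.2 (squeeze_zero (fun n => norm_nonneg _)
      (fun n => ?_) (tendsto_iff_norm_sub_tendsto_zero.1 hlim))
    exact lp.norm_apply_le_norm ENNReal.top_ne_zero (x n - f) u
  exact this.completeSpace_coe

end BddMeas

section KernelOp

variable {S : Type*} [MeasurableSpace S]

lemma kernelOp_apply (Q : Kernel S S) [IsMarkovKernel Q] (f : BddMeas S) (u : S) :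
    kernelOp Q f u = ∫ v, f v ∂(Q u) := rfl

lemma norm_kernelOp_le (Q : Kernel S S) [IsMarkovKernel Q] : ‖kernelOp Q‖ ≤ 1 :=
  LinearMap.mkContinuous_norm_le _ zero_le_one _

end KernelOp

/-! ### Transition functions of pure jump processes with a constant jump rate -/

/-- A transition function with constant jump rate `lam` and jump distribution `T`, in terms of
its behaviour for short times. -/
structure HasJumpKernel {E : Type*} [MeasurableSpace E] (lam : ℝ) (T : Kernel E E)
    (p : ℝ≥0 → Kernel E E) : Prop where
  stay : ∀ z, Tendsto (fun h : ℝ≥0 => (1 - (p h z).real {z}) / h) (𝓝[>] 0) (𝓝 lam)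
  jump : ∀ z B, MeasurableSet B →
    Tendsto (fun h : ℝ≥0 => (p h z).real (B \ {z}) / h) (𝓝[>] 0) (𝓝 (lam * (T z).real B))

section PureJump

variable {E : Type*} [MeasurableSpace E] [MeasurableSingletonClass E]
  {lam : ℝ} {T : Kernel E E} {p : ℝ≥0 → Kernel E E}

/-- Restrict the Chapman-Kolmogorov integral to the paths that are at `z` at the intermediate time.
-/
lemma IsTransitionFunction.mul_le_real_singleton (hp : IsTransitionFunction p) (s t : ℝ≥0) (z : E) :
    (p s z).real {z} * (p t z).real {z} ≤ (p (s + t) z).real {z} := by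
  have := hp.isMarkovKernel
  rw [measureReal_def, measureReal_def, measureReal_def, ← ENNReal.toReal_mul]
  refine ENNReal.toReal_mono (measure_ne_top _ _) ?_
  rw [hp.add s t, Kernel.comp_apply' _ _ _ (measurableSet_singleton z)]
  calc p s z {z} * p t z {z} = ∫⁻ w in {z}, p t w {z} ∂(p s z) := by
        rw [lintegral_singleton, mul_comm]
    _ ≤ _ := setLIntegral_le_lintegral _ _

lemma IsTransitionFunction.pow_le_real_singleton (hp : IsTransitionFunction p) (t : ℝ≥0) (z : E)
    (n : ℕ) : (p t z).real {z} ^ n ≤ (p (n * t) z).real {z} := by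
  have := hp.isMarkovKernel
  induction n with
  | zero => simp [hp.zero, Kernel.id_apply, measureReal_def]
  | succ n ih =>
    have h := hp.mul_le_real_singleton (n * t) t z
    rw [pow_succ, show ((n + 1 : ℕ) : ℝ≥0) * t = n * t + t by push_cast; ring]
    exact (mul_le_mul_of_nonneg_right ih measureReal_nonneg).trans h

/-- The holding time is exponential, at least as a lower bound. -/
lemma HasJumpKernel.exp_le_real_singleton (hp : IsTransitionFunction p)
    (hT : HasJumpKernel lam T p) (t : ℝ≥0) (z : E) :
    Real.exp (-(lam * t)) ≤ (p t z).real {z} := by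
  have := hp.isMarkovKernel
  rcases eq_or_ne t 0 with rfl | ht
  · simp [hp.zero, Kernel.id_apply, measureReal_def]
  have htpos : (0 : ℝ) < t := by exact_mod_cast pos_iff_ne_zero.2 ht
  -- The probability of being at `z` after time t is at least the n-th power of that after t/n. The
  -- latter is 1 - λt/n + o(1/n), so the powers tend to exp(-λt).
  have h1 : Tendsto (fun n : ℕ => t / (n : ℝ≥0)) atTop (𝓝[>] 0) := by
    refine tendsto_nhdsWithin_iff.2 ⟨?_, ?_⟩
    · have := tendsto_const_nhds (x := (t : ℝ)).div_atTop tendsto_natCast_atTop_atTop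
      rw [← NNReal.tendsto_coe]
      simpa using this
    · filter_upwards [eventually_gt_atTop 0] with n hn
      exact div_pos (pos_iff_ne_zero.2 ht) (by exact_mod_cast hn)
  have h2 := (hT.stay z).comp h1
  have h3 : Tendsto (fun n : ℕ => (n : ℝ) * ((p (t / (n : ℝ≥0)) z).real {z} - 1)) atTop
      (𝓝 (-(lam * t))) := by
    refine (h2.mul_const (-(t : ℝ))).congr' ?_ |>.trans (by simp)
    filter_upwards [eventually_gt_atTop 0] with n hn
    simp only [Function.comp_apply, NNReal.coe_div, NNReal.coe_natCast]
    have : (n : ℝ) ≠ 0 := by exact_mod_cast hn.ne'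
    field_simp
    ring
  have h4 := Real.tendsto_one_add_pow_exp_of_tendsto h3
  refine le_of_tendsto h4 ?_
  filter_upwards [eventually_gt_atTop 0] with n hn
  have hn' : (n : ℝ≥0) ≠ 0 := by exact_mod_cast hn.ne'
  have h5 := hp.pow_le_real_singleton (t / n) z n
  rw [mul_div_cancel₀ _ hn'] at h5
  simpa using h5

lemma setIntegral_compl_singleton_add {ν : Measure E} [IsFiniteMeasure ν] (F : BddMeas E) (z : E) :
    ∫ w in {z}ᶜ, F w ∂ν + ν.real {z} * F z = ∫ w, F w ∂ν := by
  rw [← integral_add_compl (measurableSet_singleton z) (BddMeas.integrable F ν),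
    integral_singleton, add_comm]
  simp

lemma real_compl_singleton {ν : Measure E} [IsProbabilityMeasure ν] (z : E) :
    ν.real {z}ᶜ = 1 - ν.real {z} := probReal_compl_eq_one_sub (measurableSet_singleton z)

/-- Only the mass away from `z` matters, and it is at most 1 - exp(-λt) ≤ λt. The uniformity in `z`
supplies the domination and the Lipschitz bound in time used below. -/
lemma HasJumpKernel.norm_sub_le (hp : IsTransitionFunction p)
    [∀ t, IsMarkovKernel (p t)] (hT : HasJumpKernel lam T p) (F : BddMeas E) (t : ℝ≥0) (z : E) :
    ‖kernelOp (p t) F z - F z‖ ≤ 2 * ‖F‖ * (lam * t) := by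
  have h1 : kernelOp (p t) F z - F z = ∫ w in {z}ᶜ, F w ∂(p t z) - (p t z).real {z}ᶜ * F z := by
    rw [kernelOp_apply, ← setIntegral_compl_singleton_add F z, real_compl_singleton]
    push_cast
    ring
  have h2 : (p t z).real {z}ᶜ ≤ lam * t := by
    rw [real_compl_singleton]
    linarith [hT.exp_le_real_singleton hp t z, Real.add_one_le_exp (-(lam * t))]
  have h3 : ‖∫ w in {z}ᶜ, F w ∂(p t z)‖ ≤ ‖F‖ * (p t z).real {z}ᶜ :=
    norm_setIntegral_le_of_norm_le_const (measure_lt_top _ _) fun w _ => BddMeas.norm_le F w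
  rw [h1]
  refine (_root_.norm_sub_le _ _).trans ?_
  rw [norm_mul, Complex.norm_real, Real.norm_of_nonneg measureReal_nonneg]
  have h4 : (p t z).real {z}ᶜ * ‖F z‖ ≤ (p t z).real {z}ᶜ * ‖F‖ := by
    gcongr
    exact BddMeas.norm_le F z
  nlinarith [norm_nonneg F]

/-- Setwise convergence of the jump intensities, integrated against a nonnegative function. -/
lemma HasJumpKernel.tendsto_setIntegral_of_nonneg [∀ t, IsMarkovKernel (p t)] [IsMarkovKernel T]
    (hT : HasJumpKernel lam T p) {f : E → ℝ} (hf : Measurable f) {M : ℝ} (h0 : ∀ w, 0 ≤ f w)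
    (hM : ∀ w, f w ≤ M) (z : E) :
    Tendsto (fun h : ℝ≥0 => (∫ w in {z}ᶜ, f w ∂(p h z)) / h) (𝓝[>] 0)
      (𝓝 (lam * ∫ w, f w ∂(T z))) := by
  -- Layer cake formula: it reduces integrals to measures of superlevel sets, where setwise
  -- convergence applies. The domination over the levels comes from the total exit rate, eventually
  -- at most `lam + 1`.
  have hlc : ∀ (ν : Measure E) [IsFiniteMeasure ν],
      ∫ w, f w ∂ν = ∫ t in Set.Ioc 0 M, ν.real {a | t ≤ f a} := fun ν _ =>
    Integrable.integral_eq_integral_Ioc_meas_le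
      (Integrable.of_bound hf.aestronglyMeasurable M
        (ae_of_all _ fun w => by rw [Real.norm_of_nonneg (h0 w)]; exact hM w))
      (ae_of_all _ h0) (ae_of_all _ hM)
  have hms : ∀ t : ℝ, MeasurableSet {a | t ≤ f a} := fun t => measurableSet_le measurable_const hf
  rw [hlc, ← integral_const_mul]
  have he : ∀ h : ℝ≥0, (∫ w in {z}ᶜ, f w ∂(p h z)) / h =
      ∫ t in Set.Ioc 0 M, (p h z).real ({a | t ≤ f a} \ {z}) / h := by
    intro h
    rw [hlc, integral_div]
    congr 1
    refine integral_congr_ae (ae_of_all _ fun t => ?_)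
    simp only [measureReal_restrict_apply (hms t), Set.sdiff_eq]
  simp_rw [he]
  refine tendsto_integral_filter_of_dominated_convergence (fun _ => lam + 1) ?_ ?_
    (integrable_const _) (ae_of_all _ fun t => hT.jump z _ (hms t))
  · refine Eventually.of_forall fun h => Measurable.aestronglyMeasurable ?_
    refine Measurable.div_const ?_ _
    refine Antitone.measurable fun s t hst => ?_
    exact measureReal_mono (Set.sdiff_subset_sdiff_left fun a ha => le_trans hst ha)
  · filter_upwards [(hT.stay z).eventually (eventually_le_nhds (lt_add_one lam))] with h hh
    refine ae_of_all _ fun t => ?_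
    rw [Real.norm_of_nonneg (by positivity)]
    refine le_trans ?_ hh
    gcongr
    rw [← real_compl_singleton]
    exact measureReal_mono (fun a ha => ha.2)

/-- Adding the bound `M` makes the function nonnegative; the added constant contributes `M` times
the exit rate, which converges to `lam * M`. -/
lemma HasJumpKernel.tendsto_setIntegral_real [∀ t, IsMarkovKernel (p t)] [IsMarkovKernel T]
    (hT : HasJumpKernel lam T p) {f : E → ℝ} (hf : Measurable f) {M : ℝ} (hM : ∀ w, |f w| ≤ M)
    (z : E) :
    Tendsto (fun h : ℝ≥0 => (∫ w in {z}ᶜ, f w ∂(p h z)) / h) (𝓝[>] 0)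
      (𝓝 (lam * ∫ w, f w ∂(T z))) := by
  have hint : ∀ (ν : Measure E) [IsFiniteMeasure ν], Integrable f ν := fun ν _ =>
    Integrable.of_bound hf.aestronglyMeasurable M (ae_of_all _ hM)
  have h1 := hT.tendsto_setIntegral_of_nonneg (f := fun w => f w + M) (hf.add_const M) (M := 2 * M)
    (fun w => by linarith [neg_abs_le (f w), hM w]) (fun w => by linarith [le_abs_self (f w), hM w]) z
  have h2 := (hT.stay z).mul_const M
  refine (h1.sub h2).congr (fun h => ?_) |>.trans (le_of_eq ?_)
  · rw [integral_add (hint _) (integrable_const _), integral_const, smul_eq_mul,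
      ← real_compl_singleton, measureReal_restrict_apply MeasurableSet.univ, Set.univ_inter]
    ring
  · rw [integral_add (hint _) (integrable_const _), integral_const, smul_eq_mul]
    simp only [probReal_univ]
    congr 1
    ring

/-- The generator of the semigroup is `lam * (T - 1)`, pointwise. -/
lemma HasJumpKernel.tendsto_generator [∀ t, IsMarkovKernel (p t)] [IsMarkovKernel T]
    (hT : HasJumpKernel lam T p) (F : BddMeas E) (z : E) :
    Tendsto (fun h : ℝ≥0 => (kernelOp (p h) F z - F z) / (h : ℂ)) (𝓝[>] 0)
      (𝓝 (lam * (kernelOp T F z - F z))) := by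
  have hre := hT.tendsto_setIntegral_real (f := fun w => (F w).re)
    (Complex.measurable_re.comp (BddMeas.measurable F))
    (fun w => (Complex.abs_re_le_norm _).trans (BddMeas.norm_le F w)) z
  have him := hT.tendsto_setIntegral_real (f := fun w => (F w).im)
    (Complex.measurable_im.comp (BddMeas.measurable F))
    (fun w => (Complex.abs_im_le_norm _).trans (BddMeas.norm_le F w)) z
  have hdec : ∀ (ν : Measure E) [IsFiniteMeasure ν],
      ∫ w, F w ∂ν = ((∫ w, (F w).re ∂ν : ℝ) : ℂ) + ((∫ w, (F w).im ∂ν : ℝ) : ℂ) * Complex.I :=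
    fun ν _ => (integral_re_add_im (BddMeas.integrable F ν)).symm
  have hc : ∀ {g : ℝ≥0 → ℝ} {a : ℝ}, Tendsto g (𝓝[>] 0) (𝓝 a) →
      Tendsto (fun h => (g h : ℂ)) (𝓝[>] 0) (𝓝 (a : ℂ)) := fun hg =>
    (Complex.continuous_ofReal.tendsto _).comp hg
  refine (((hc hre).add ((hc him).mul_const Complex.I)).sub
    ((hc (hT.stay z)).mul_const (F z))).congr (fun h => ?_) |>.trans (le_of_eq ?_)
  · rw [kernelOp_apply, ← setIntegral_compl_singleton_add F z, hdec]
    push_cast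
    ring
  · rw [kernelOp_apply, hdec]
    push_cast
    congr 1
    ring

/-- By Chapman-Kolmogorov the difference quotient at time r is the average under `p r` of the
difference quotients at time 0, so the pointwise generator can be integrated by dominated
convergence. -/
lemma HasJumpKernel.hasDerivWithinAt (hp : IsTransitionFunction p)
    [∀ t, IsMarkovKernel (p t)] [IsMarkovKernel T]
    (hT : HasJumpKernel lam T p) (F : BddMeas E) (z : E) {r : ℝ} (hr : 0 ≤ r) :
    HasDerivWithinAt (fun s : ℝ => kernelOp (p s.toNNReal) F z)
      (kernelOp (p r.toNNReal) (stepGenerator lam (kernelOp T) F) z) (Set.Ici r) r := by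
  rw [hasDerivWithinAt_iff_tendsto_slope, Set.Ici_sdiff_left]
  have hsub : Tendsto (fun s : ℝ => (s - r).toNNReal) (𝓝[>] r) (𝓝[>] 0) := by
    refine tendsto_nhdsWithin_iff.2 ⟨?_, ?_⟩
    · have : Continuous (fun s : ℝ => (s - r).toNNReal) := by fun_prop
      simpa using (this.tendsto r).mono_left nhdsWithin_le_nhds
    · filter_upwards [self_mem_nhdsWithin] with s hs
      exact Real.toNNReal_pos.2 (sub_pos.2 hs)
  have key : Tendsto (fun s : ℝ => ∫ w, (kernelOp (p (s - r).toNNReal) F w - F w) /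
      (((s - r).toNNReal : ℝ) : ℂ) ∂(p r.toNNReal z)) (𝓝[>] r)
      (𝓝 (∫ w, stepGenerator lam (kernelOp T) F w ∂(p r.toNNReal z))) := by
    refine tendsto_integral_filter_of_dominated_convergence (fun _ => 2 * ‖F‖ * lam) ?_ ?_
      (integrable_const _) (ae_of_all _ fun w => ?_)
    · refine Eventually.of_forall fun s => Measurable.aestronglyMeasurable ?_
      exact ((BddMeas.measurable (kernelOp (p (s - r).toNNReal) F)).sub (BddMeas.measurable F)).div_const _
    · filter_upwards [self_mem_nhdsWithin] with s hs
      refine ae_of_all _ fun w => ?_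
      have hpos : (0 : ℝ) < ((s - r).toNNReal : ℝ) := by
        exact_mod_cast Real.toNNReal_pos.2 (sub_pos.2 hs)
      rw [norm_div, Complex.norm_real, Real.norm_of_nonneg hpos.le, div_le_iff₀ hpos]
      have := hT.norm_sub_le hp F (s - r).toNNReal w
      linarith
    · exact (hT.tendsto_generator F w).comp hsub
  refine key.congr' ?_
  filter_upwards [self_mem_nhdsWithin] with s hs
  have hs' : r < s := hs
  have hadd : s.toNNReal = r.toNNReal + (s - r).toNNReal := by
    rw [← Real.toNNReal_add hr (sub_nonneg.2 hs'.le)]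
    congr 1
    ring
  have h1 : kernelOp (p s.toNNReal) F z =
      ∫ w, kernelOp (p (s - r).toNNReal) F w ∂(p r.toNNReal z) := by
    rw [hadd, kernelOp_apply, hp.add]
    exact Kernel.integral_comp (BddMeas.integrable F _)
  rw [integral_div, integral_sub (BddMeas.integrable _ _) (BddMeas.integrable _ _), ← h1,
    ← kernelOp_apply, slope_def_module, Real.coe_toNNReal _ (sub_nonneg.2 hs'.le),
    div_eq_inv_mul, Complex.real_smul]
  push_cast
  rfl

/-- The right derivative does not control the left limits; averaging `HasJumpKernel.norm_sub_le`
over the earlier position gives a Lipschitz bound in time. -/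
lemma HasJumpKernel.continuousOn (hlam : 0 ≤ lam) (hp : IsTransitionFunction p)
    [∀ t, IsMarkovKernel (p t)] (hT : HasJumpKernel lam T p) (F : BddMeas E) (z : E) :
    ContinuousOn (fun s : ℝ => kernelOp (p s.toNNReal) F z) (Set.Ici 0) := by
  have hle : ∀ r s : ℝ, 0 ≤ r → r ≤ s →
      ‖kernelOp (p s.toNNReal) F z - kernelOp (p r.toNNReal) F z‖ ≤ 2 * ‖F‖ * lam * (s - r) := by
    intro r s hr hrs
    have hadd : s.toNNReal = r.toNNReal + (s - r).toNNReal := by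
      rw [← Real.toNNReal_add hr (sub_nonneg.2 hrs)]
      congr 1
      ring
    have h1 : kernelOp (p s.toNNReal) F z =
        ∫ w, kernelOp (p (s - r).toNNReal) F w ∂(p r.toNNReal z) := by
      rw [hadd, kernelOp_apply, hp.add]
      exact Kernel.integral_comp (BddMeas.integrable F _)
    rw [h1, kernelOp_apply, ← integral_sub (BddMeas.integrable _ _) (BddMeas.integrable _ _)]
    refine (norm_integral_le_of_norm_le_const (ae_of_all _ fun w =>
      hT.norm_sub_le hp F (s - r).toNNReal w)).trans (le_of_eq ?_)
    rw [probReal_univ, Real.coe_toNNReal _ (sub_nonneg.2 hrs)]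
    ring
  refine (LipschitzOnWith.of_dist_le_mul (K := (2 * ‖F‖ * lam).toNNReal) ?_).continuousOn
  intro r hr s hs
  rw [Real.coe_toNNReal _ (by positivity), Real.dist_eq]
  rcases le_total r s with h | h
  · rw [dist_comm, dist_eq_norm, abs_sub_comm, abs_of_nonneg (sub_nonneg.2 h)]
    exact hle r s hr h
  · rw [dist_eq_norm, abs_of_nonneg (sub_nonneg.2 h)]
    exact hle s r hs h

/-- The semigroup of a transition function with bounded jump rates is the exponential of its
generator. -/
theorem HasJumpKernel.kernelOp_eq_exp (hlam : 0 ≤ lam) (hp : IsTransitionFunction p)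
    [∀ t, IsMarkovKernel (p t)] [IsMarkovKernel T]
    (hT : HasJumpKernel lam T p) (t : ℝ≥0) :
    kernelOp (p t) = stepSemigroup lam (kernelOp T) t := by
  have h := eq_exp_smul_of_hasDerivWithinAt (U := fun s => kernelOp (p s.toNNReal))
    (G := stepGenerator lam (kernelOp T)) (φ := fun z : E => BddMeas.evalCLM z)
    (fun z F => BddMeas.norm_le F z) (fun F h => BddMeas.ext h) ?_
    (fun s => norm_kernelOp_le _) (fun z F => hT.continuousOn hlam hp F z)
    (fun z F s hs => hT.hasDerivWithinAt hp F z hs) t.coe_nonneg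
  · rwa [Real.toNNReal_coe] at h
  · ext F z
    simp [hp.zero, kernelOp_apply, Kernel.id_apply, integral_dirac' _ _
      (BddMeas.measurable F).stronglyMeasurable]

end PureJump

/-! ### The joint law of displacement and new internal state -/

section JumpKernel

variable {d : ℕ} {S : Type*} [MeasurableSpace S] {P : (Fin d → ℤ) → Kernel S S}

/-- The joint law of the displacement and the new internal state in one jump. -/
noncomputable def jumpKernel (P : (Fin d → ℤ) → Kernel S S) : Kernel S ((Fin d → ℤ) × S) :=
  Kernel.sum fun y => (P y).map (Prod.mk y)

lemma jumpKernel_apply (u : S) :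
    jumpKernel P u = Measure.sum fun y => (P y u).map (Prod.mk y) := by
  rw [jumpKernel, Kernel.sum_apply]
  congr 1
  ext1 y
  rw [Kernel.map_apply _ measurable_prodMk_left]

lemma jumpKernel_apply' (u : S) {B : Set ((Fin d → ℤ) × S)} (hB : MeasurableSet B) :
    jumpKernel P u B = ∑' y, P y u (Prod.mk y ⁻¹' B) := by
  rw [jumpKernel_apply, Measure.sum_apply _ hB]
  congr 1
  ext1 y
  rw [Measure.map_apply measurable_prodMk_left hB]

lemma map_snd_jumpKernel (u : S) : (jumpKernel P u).map Prod.snd = Kernel.sum P u := by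
  ext B hB
  rw [Measure.map_apply measurable_snd hB, jumpKernel_apply' u (measurable_snd hB),
    Kernel.sum_apply' _ _ hB]
  rfl

instance [IsMarkovKernel (Kernel.sum P)] : IsMarkovKernel (jumpKernel P) := by
  refine ⟨fun u => ⟨?_⟩⟩
  rw [← Set.preimage_univ (f := Prod.snd), ← Measure.map_apply measurable_snd .univ,
    map_snd_jumpKernel]
  exact measure_univ

lemma integral_comp_snd_jumpKernel {F : Type*} [NormedAddCommGroup F] [NormedSpace ℝ F]
    (u : S) {f : S → F} (hf : StronglyMeasurable f) :
    ∫ w, f w.2 ∂(jumpKernel P u) = ∫ v, f v ∂(Kernel.sum P u) := by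
  rw [← map_snd_jumpKernel, integral_map measurable_snd.aemeasurable hf.aestronglyMeasurable]

lemma lintegral_jumpKernel (u : S) {φ : (Fin d → ℤ) × S → ℝ≥0∞} (hφ : Measurable φ) :
    ∫⁻ w, φ w ∂(jumpKernel P u) = ∑' y, ∫⁻ v, φ (y, v) ∂(P y u) := by
  rw [jumpKernel_apply, lintegral_sum_measure]
  congr 1
  ext1 y
  rw [lintegral_map hφ measurable_prodMk_left]

lemma integral_jumpKernel (u : S) {φ : (Fin d → ℤ) × S → ℝ} (hφ : Measurable φ)
    (hint : Integrable φ (jumpKernel P u)) :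
    ∫ w, φ w ∂(jumpKernel P u) = ∑' y, ∫ v, φ (y, v) ∂(P y u) := by
  rw [jumpKernel_apply] at hint ⊢
  rw [integral_sum_measure hint]
  congr 1
  ext1 y
  rw [integral_map measurable_prodMk_left.aemeasurable hφ.aestronglyMeasurable]

/-- The transition kernel of the chain of states visited by the walk. -/
noncomputable def stepKernel (P : (Fin d → ℤ) → Kernel S S) :
    Kernel ((Fin d → ℤ) × S) ((Fin d → ℤ) × S) where
  toFun z := (jumpKernel P z.2).map (fun w => (z.1 + w.1, w.2))
  measurable' := by
    refine measurable_from_prod_countable_right fun x => ?_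
    exact (Measure.measurable_map (fun w : (Fin d → ℤ) × S => (x + w.1, w.2)) (by fun_prop)).comp (jumpKernel P).measurable

lemma stepKernel_apply (x : Fin d → ℤ) (v : S) :
    stepKernel P (x, v) = (jumpKernel P v).map (fun w => (x + w.1, w.2)) := rfl

instance [IsMarkovKernel (Kernel.sum P)] : IsMarkovKernel (stepKernel P) :=
  ⟨fun z => Measure.isProbabilityMeasure_map (by fun_prop)⟩

lemma kernelOp_stepKernel_apply [IsMarkovKernel (Kernel.sum P)] (F : BddMeas ((Fin d → ℤ) × S))
    (x : Fin d → ℤ) (v : S) :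
    kernelOp (stepKernel P) F (x, v) = ∫ w, F (x + w.1, w.2) ∂(jumpKernel P v) := by
  rw [kernelOp_apply, stepKernel_apply, integral_map (by fun_prop)
    (BddMeas.measurable F).aestronglyMeasurable]

lemma hasSum_stepKernel_real [IsMarkovKernel (Kernel.sum P)] (x : Fin d → ℤ) (v : S)
    {B : Set ((Fin d → ℤ) × S)} (hB : MeasurableSet B) :
    HasSum (fun y => (P y v).real {v' | (x + y, v') ∈ B}) ((stepKernel P (x, v)).real B) := by
  have h1 : stepKernel P (x, v) B = ∑' y, P y v {v' | (x + y, v') ∈ B} := by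
    rw [stepKernel_apply, Measure.map_apply (by fun_prop) hB,
      jumpKernel_apply' v (hB.preimage (by fun_prop))]
    rfl
  have h2 : ∑' y, P y v {v' | (x + y, v') ∈ B} ≠ ∞ := h1 ▸ measure_ne_top _ _
  rw [measureReal_def, h1, ENNReal.tsum_toReal_eq (fun y => ENNReal.ne_top_of_tsum_ne_top h2 y)]
  exact (ENNReal.summable_toReal h2).hasSum

lemma HasJumpRates.stay_tendsto [MeasurableSingletonClass S] {lam : ℝ}
    {p : ℝ≥0 → Kernel ((Fin d → ℤ) × S) ((Fin d → ℤ) × S)} (hrates : HasJumpRates lam P p)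
    (z : (Fin d → ℤ) × S) :
    Tendsto (fun h : ℝ≥0 => (1 - (p h z).real {z}) / h) (𝓝[>] 0) (𝓝 lam) := by
  have h1 := (hrates.stay z).tendsto_div_nhds_zero.const_sub lam
  rw [sub_zero] at h1
  refine h1.congr' ?_
  filter_upwards [self_mem_nhdsWithin] with h hh
  have : (h : ℝ) ≠ 0 := by exact_mod_cast (ne_of_gt hh)
  field_simp
  ring

lemma HasJumpRates.jump_tendsto {lam : ℝ}
    {p : ℝ≥0 → Kernel ((Fin d → ℤ) × S) ((Fin d → ℤ) × S)} (hrates : HasJumpRates lam P p)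
    (x y : Fin d → ℤ) (v : S) {A : Set S} (hy : y ≠ 0) (hA : MeasurableSet A) :
    Tendsto (fun h : ℝ≥0 => (p h (x, v)).real ({x + y} ×ˢ A) / h) (𝓝[>] 0)
      (𝓝 (lam * (P y v).real A)) := by
  have h1 := (hrates.jump x y v A hy hA).tendsto_div_nhds_zero.add_const (lam * (P y v).real A)
  rw [zero_add] at h1
  refine h1.congr' ?_
  filter_upwards [self_mem_nhdsWithin] with h hh
  have : (h : ℝ) ≠ 0 := by exact_mod_cast (ne_of_gt hh)
  field_simp
  ring

/-- A Fatou argument: finitely many displacements carry the intensity of `B` up to δ/2, and for each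
of them the rate is prescribed. Displacement 0 can be dropped because `P 0 = 0`; the other slices
are disjoint and avoid `z`. Infinitely many displacements prevent a direct upper bound of this kind.
-/
lemma HasJumpRates.eventually_le {lam : ℝ}
    (hP0 : P 0 = 0) [IsMarkovKernel (Kernel.sum P)]
    {p : ℝ≥0 → Kernel ((Fin d → ℤ) × S) ((Fin d → ℤ) × S)} [∀ t, IsMarkovKernel (p t)]
    (hrates : HasJumpRates lam P p) (z : (Fin d → ℤ) × S) {B : Set ((Fin d → ℤ) × S)}
    (hB : MeasurableSet B) {δ : ℝ} (hδ : 0 < δ) :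
    ∀ᶠ h : ℝ≥0 in 𝓝[>] 0, lam * (stepKernel P z).real B - δ < (p h z).real (B \ {z}) / h := by
  classical
  obtain ⟨x, v⟩ := z
  let A : (Fin d → ℤ) → Set S := fun y => {v' | (x + y, v') ∈ B}
  have hA : ∀ y, MeasurableSet (A y) := fun y => hB.preimage measurable_prodMk_left
  have hsum := (hasSum_stepKernel_real (P := P) x v hB).mul_left lam
  obtain ⟨s, hs⟩ := ((hsum.eventually (lt_mem_nhds (sub_lt_self _ (half_pos hδ)))).exists)
  have hlim : Tendsto (fun h : ℝ≥0 => ∑ y ∈ s.erase 0, (p h (x, v)).real ({x + y} ×ˢ A y) / h)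
      (𝓝[>] 0) (𝓝 (∑ y ∈ s, lam * (P y v).real (A y))) := by
    have h0 : ∑ y ∈ s, lam * (P y v).real (A y) = ∑ y ∈ s.erase 0, lam * (P y v).real (A y) := by
      refine (Finset.sum_erase s ?_).symm
      simp [hP0]
    rw [h0]
    exact tendsto_finsetSum _ fun y hy =>
      hrates.jump_tendsto x y v (Finset.ne_of_mem_erase hy) (hA y)
  filter_upwards [hlim.eventually (lt_mem_nhds (sub_lt_self _ (half_pos hδ)))] with h hh
  have hle : ∑ y ∈ s.erase 0, (p h (x, v)).real ({x + y} ×ˢ A y) / h ≤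
      (p h (x, v)).real (B \ {(x, v)}) / h := by
    rw [← Finset.sum_div]
    gcongr
    rw [← measureReal_biUnion_finset]
    · refine measureReal_mono ?_
      intro w hw
      simp only [Set.mem_iUnion] at hw
      obtain ⟨y, hy, hw1, hw2⟩ := hw
      have hw1 : w.1 = x + y := hw1
      refine ⟨?_, ?_⟩
      · have : (x + y, w.2) ∈ B := hw2
        rwa [← hw1] at this
      · rintro rfl
        simp at hw1
        exact Finset.ne_of_mem_erase hy hw1
    · intro y _ y' _ hyy
      refine Set.disjoint_left.2 fun w hw hw' => hyy ?_
      have h1 : w.1 = x + y := hw.1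
      have h2 : w.1 = x + y' := hw'.1
      exact add_left_cancel (h1.symm.trans h2)
    · exact fun y _ => (measurableSet_singleton _).prod (hA y)
  linarith

/-- The infinitesimal description of the walk determines all jump intensities setwise. -/
lemma HasJumpRates.hasJumpKernel [MeasurableSingletonClass S] {lam : ℝ}
    (hP0 : P 0 = 0) [IsMarkovKernel (Kernel.sum P)]
    {p : ℝ≥0 → Kernel ((Fin d → ℤ) × S) ((Fin d → ℤ) × S)} [∀ t, IsMarkovKernel (p t)]
    (hrates : HasJumpRates lam P p) : HasJumpKernel lam (stepKernel P) p where
  stay := hrates.stay_tendsto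
  jump z B hB := by
    refine tendsto_order.2 ⟨fun a ha => ?_, fun a ha => ?_⟩
    · have := hrates.eventually_le hP0 z hB (sub_pos.2 ha)
      simpa using this
    -- The upper bound follows from the lower bound for the complement, since the rates of `B` and
    -- `Bᶜ` add up to the exit rate, which tends to `lam`.
    · set δ := a - lam * (stepKernel P z).real B
      have hδ : 0 < δ := sub_pos.2 ha
      filter_upwards [hrates.eventually_le hP0 z hB.compl (half_pos hδ),
        (hrates.stay_tendsto z).eventually (gt_mem_nhds (lt_add_of_pos_right _ (half_pos hδ)))]
        with h h1 h2
      have h3 : (p h z).real (B \ {z}) / h + (p h z).real (Bᶜ \ {z}) / h =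
          (1 - (p h z).real {z}) / h := by
        rw [← add_div, ← real_compl_singleton]
        congr 1
        rw [← measureReal_inter_add_sdiff (s := {z}ᶜ) hB]
        congr 2 <;> ext w <;> simp <;> tauto
      rw [probReal_compl_eq_one_sub hB] at h1
      have : lam * (1 - (stepKernel P z).real B) = lam - lam * (stepKernel P z).real B := by ring
      linarith [show δ = a - lam * (stepKernel P z).real B from rfl]

end JumpKernel

/-! ### The Poisson equation -/

section Poisson

variable {S : Type*} [MeasurableSpace S] {Q : Kernel S S} [IsMarkovKernel Q] {ρ : Measure S}
  [IsProbabilityMeasure ρ]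

omit [IsProbabilityMeasure ρ] in
lemma integral_bind_kernel [IsFiniteMeasure ρ] (f : BddMeas S) :
    ∫ u, f u ∂(ρ.bind Q) = ∫ u, kernelOp Q f u ∂ρ := by
  have h := Kernel.integral_comp (κ := Kernel.const Unit ρ) (η := Q) (a := ()) (f := fun u => f u)
    (BddMeas.integrable f _)
  rwa [Kernel.comp_apply, Kernel.const_apply] at h

lemma integral_kernelOp_of_invariant (hρ : Q.Invariant ρ) (f : BddMeas S) :
    ∫ u, kernelOp Q f u ∂ρ = ∫ u, f u ∂ρ := by
  rw [← integral_bind_kernel, hρ]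

/-- Under a spectral gap, `Q - 1` maps onto the functions with mean zero. -/
lemma HasSpectralGap.exists_kernelOp_sub_eq (hgap : HasSpectralGap Q) (hρ : Q.Invariant ρ)
    (g : BddMeas S) (hg : ∫ u, g u ∂ρ = 0) : ∃ f : BddMeas S, kernelOp Q f - f = g := by
  have hS : Nonempty S := nonempty_of_isProbabilityMeasure ρ
  let e : BddMeas S := BddMeas.ofBound (fun _ => 1) measurable_const 1 (by simp)
  have he : e ∈ (kernelOp Q - 1 : BddMeas S →L[ℂ] BddMeas S).ker := by
    rw [LinearMap.mem_ker]
    ext u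
    change ∫ _, (1 : ℂ) ∂(Q u) - 1 = 0
    simp
  have hne : (⟨e, he⟩ : (kernelOp Q - 1 : BddMeas S →L[ℂ] BddMeas S).ker) ≠ 0 := by
    intro h
    have h1 : e = 0 := congrArg Subtype.val h
    have h2 : (1 : ℂ) = 0 := congrArg (fun f : BddMeas S => f hS.some) h1
    exact one_ne_zero h2
  have hmem : g ∈ (kernelOp Q - 1 : BddMeas S →L[ℂ] BddMeas S).ker ⊔
      (kernelOp Q - 1 : BddMeas S →L[ℂ] BddMeas S).range := by
    rw [hgap.isCompl.sup_eq_top]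
    trivial
  obtain ⟨k, hk, r, ⟨f, hf⟩, hkr⟩ := Submodule.mem_sup.1 hmem
  obtain ⟨c, hc⟩ := (finrank_eq_one_iff_of_nonzero' _ hne).1 hgap.finrank_ker ⟨k, hk⟩
  have hk' : k = c • e := (congrArg Subtype.val hc).symm
  have hf' : kernelOp Q f - f = r := hf
  -- The kernel of Q - 1 consists of the constants, so g = c + (Qf - f). Integrating against the
  -- invariant measure leaves c = 0.
  have hc0 : c = 0 := by
    have h1 : ∀ u, g u = c + (kernelOp Q f u - f u) := by
      intro u
      rw [← hkr, hk', ← hf']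
      change c * 1 + _ = _
      rw [mul_one]
      rfl
    simp_rw [h1] at hg
    have hi : Integrable (fun u => kernelOp Q f u - f u) ρ :=
      (BddMeas.integrable (kernelOp Q f) ρ).sub (BddMeas.integrable f ρ)
    rw [integral_add (integrable_const _) hi,
      integral_sub (BddMeas.integrable (kernelOp Q f) ρ) (BddMeas.integrable f ρ),
      integral_kernelOp_of_invariant hρ] at hg
    simpa using hg
  refine ⟨f, ?_⟩
  rw [hf', ← hkr, hk', hc0, zero_smul, zero_add]

/-- The real part of a complex solution, minus its mean, still solves the equation because Q is real
and fixes constants. -/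
lemma HasSpectralGap.exists_isCenteredSolution (hgap : HasSpectralGap Q) (hρ : Q.Invariant ρ)
    {g : S → ℝ} (hg : Measurable g) {C : ℝ} (hC : ∀ u, |g u| ≤ C) (h0 : ∫ u, g u ∂ρ = 0) :
    ∃ f, IsCenteredSolution Q ρ g f := by
  obtain ⟨f, hf⟩ := hgap.exists_kernelOp_sub_eq hρ
    (BddMeas.ofBound (fun u => (g u : ℂ)) (Complex.measurable_ofReal.comp hg) C
      (fun u => by rw [Complex.norm_real]; exact hC u)) (by
        simp only [BddMeas.ofBound_apply]
        rw [integral_complex_ofReal, h0, Complex.ofReal_zero])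
  have hre : ∀ (ν : Measure S) [IsProbabilityMeasure ν], Integrable (fun u => (f u).re) ν :=
    fun ν _ => (BddMeas.integrable f ν).re
  have hb : ∀ u, |(f u).re| ≤ ‖f‖ := fun u =>
    (Complex.abs_re_le_norm _).trans (BddMeas.norm_le f u)
  refine ⟨fun u => (f u).re - ∫ v, (f v).re ∂ρ,
    ⟨(Complex.measurable_re.comp (BddMeas.measurable f)).sub_const _,
      ⟨‖f‖ + |∫ v, (f v).re ∂ρ|, fun u => (abs_sub _ _).trans (by gcongr; exact hb u)⟩, ?_, ?_⟩⟩
  · rw [integral_sub (hre ρ) (integrable_const _)]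
    simp
  · intro u
    have h1 : (kernelOp Q f u - f u).re = g u := by
      have := congrArg (fun k : BddMeas S => (k u).re) hf
      simpa using this
    rw [integral_sub (hre _) (integrable_const _), ← h1, Complex.sub_re, kernelOp_apply]
    have h2 : ∫ v, (f v).re ∂(Q u) = (∫ v, f v ∂(Q u)).re :=
      integral_re (BddMeas.integrable f (Q u))
    simp [h2]

end Poisson

/-! ### Moments of the jumps -/

section Moments

variable {d : ℕ} {S : Type*} [MeasurableSpace S] {P : (Fin d → ℤ) → Kernel S S}

/-- The component of the displacement `y` in the direction `θ`. -/
def displacement (θ : Fin d → ℝ) (y : Fin d → ℤ) : ℝ := ∑ l, θ l * (y l : ℝ)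

lemma displacement_add (θ : Fin d → ℝ) (x y : Fin d → ℤ) :
    displacement θ (x + y) = displacement θ x + displacement θ y := by
  simp [displacement, mul_add, Finset.sum_add_distrib]

@[fun_prop] lemma measurable_displacement (θ : Fin d → ℝ) : Measurable (displacement θ) :=
  measurable_of_countable _

lemma abs_intCast_apply_le (y : Fin d → ℤ) (l : Fin d) : |(y l : ℝ)| ≤ ‖y‖ := by
  rw [← Int.norm_eq_abs]
  exact norm_le_pi_norm y l

lemma abs_displacement_le (θ : Fin d → ℝ) (y : Fin d → ℤ) :
    |displacement θ y| ≤ (∑ l, |θ l|) * ‖y‖ := by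
  rw [displacement, Finset.sum_mul]
  refine (Finset.abs_sum_le_sum_abs _ _).trans (Finset.sum_le_sum fun l _ => ?_)
  rw [abs_mul]
  gcongr
  exact abs_intCast_apply_le y l

lemma HasFiniteMoments.exists_integral_norm_pow_le (hmom : HasFiniteMoments P) (k : ℕ) :
    ∃ C : ℝ, ∀ u, Integrable (fun w => ‖w.1‖ ^ k) (jumpKernel P u) ∧
      ∫ w, ‖w.1‖ ^ k ∂(jumpKernel P u) ≤ C := by
  obtain ⟨C, hC⟩ := hmom k
  have hm : Measurable (fun w : (Fin d → ℤ) × S => ‖w.1‖ ^ k) := by fun_prop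
  have hlin : ∀ u, ∫⁻ w, ENNReal.ofReal (‖w.1‖ ^ k) ∂(jumpKernel P u) ≤ C := by
    intro u
    rw [lintegral_jumpKernel u (by fun_prop)]
    refine le_trans (le_of_eq ?_) (hC u)
    congr 1
    ext1 y
    change ∫⁻ _, ENNReal.ofReal (‖y‖ ^ k) ∂(P y u) = _
    rw [lintegral_const, ENNReal.ofReal_pow (norm_nonneg _), ofReal_norm, enorm_eq_nnnorm]
  refine ⟨C, fun u => ⟨⟨hm.aestronglyMeasurable, ?_⟩, ?_⟩⟩
  · rw [hasFiniteIntegral_iff_ofReal (ae_of_all _ fun w => by positivity)]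
    exact (hlin u).trans_lt ENNReal.coe_lt_top
  · rw [integral_eq_lintegral_of_nonneg_ae (ae_of_all _ fun w => by positivity)
      hm.aestronglyMeasurable]
    exact ENNReal.toReal_le_of_le_ofReal C.2 (by simpa using hlin u)

lemma HasFiniteMoments.exists_integral_displacement_pow_le (hmom : HasFiniteMoments P)
    (θ : Fin d → ℝ) (k : ℕ) :
    ∃ C : ℝ, ∀ u, Integrable (fun w => |displacement θ w.1| ^ k) (jumpKernel P u) ∧
      ∫ w, |displacement θ w.1| ^ k ∂(jumpKernel P u) ≤ C := by
  obtain ⟨C, hC⟩ := hmom.exists_integral_norm_pow_le k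
  have hle : ∀ w : (Fin d → ℤ) × S,
      |displacement θ w.1| ^ k ≤ (∑ l, |θ l|) ^ k * ‖w.1‖ ^ k := fun w => by
    rw [← mul_pow]
    exact pow_le_pow_left₀ (abs_nonneg _) (abs_displacement_le θ w.1) k
  refine ⟨(∑ l, |θ l|) ^ k * C, fun u => ?_⟩
  have hint : Integrable (fun w => |displacement θ w.1| ^ k) (jumpKernel P u) := by
    refine ((hC u).1.const_mul ((∑ l, |θ l|) ^ k)).mono' ?_ (ae_of_all _ fun w => ?_)
    · exact Measurable.aestronglyMeasurable (by fun_prop)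
    · rw [Real.norm_of_nonneg (by positivity)]
      exact hle w
  refine ⟨hint, (integral_mono hint ((hC u).1.const_mul _) hle).trans ?_⟩
  rw [integral_const_mul]
  have : 0 ≤ ∑ l, |θ l| := Finset.sum_nonneg fun l _ => abs_nonneg _
  gcongr
  exact (hC u).2

lemma HasFiniteMoments.integrable_of_le (hmom : HasFiniteMoments P) {φ : (Fin d → ℤ) × S → ℝ}
    (hφ : Measurable φ) {C : ℝ} {k : ℕ} (h : ∀ w, |φ w| ≤ C * ‖w.1‖ ^ k) (u : S) :
    Integrable φ (jumpKernel P u) := by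
  obtain ⟨_, hD⟩ := hmom.exists_integral_norm_pow_le k
  exact ((hD u).1.const_mul C).mono' hφ.aestronglyMeasurable (ae_of_all _ h)

lemma HasFiniteMoments.exists_abs_integral_le (hmom : HasFiniteMoments P)
    {φ : (Fin d → ℤ) × S → ℝ} {C : ℝ} (hC0 : 0 ≤ C) {k : ℕ}
    (h : ∀ w, |φ w| ≤ C * ‖w.1‖ ^ k) : ∃ D : ℝ, ∀ u, |∫ w, φ w ∂(jumpKernel P u)| ≤ D := by
  obtain ⟨D, hD⟩ := hmom.exists_integral_norm_pow_le k
  refine ⟨C * D, fun u => ?_⟩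
  refine (norm_integral_le_of_norm_le ((hD u).1.const_mul C)
    (ae_of_all _ fun w => (Real.norm_eq_abs (φ w)).le.trans (h w))).trans ?_
  rw [integral_const_mul]
  gcongr
  exact (hD u).2

lemma measurable_integral_jumpKernel [IsMarkovKernel (Kernel.sum P)] {φ : (Fin d → ℤ) × S → ℝ}
    (hφ : Measurable φ) : Measurable fun u => ∫ w, φ w ∂(jumpKernel P u) :=
  (StronglyMeasurable.integral_kernel (κ := jumpKernel P) hφ.stronglyMeasurable).measurable

lemma abs_intCast_mul_le {S : Type*} {f : S → ℝ} {C : ℝ} (hC : ∀ u, |f u| ≤ C) (l : Fin d)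
    (w : (Fin d → ℤ) × S) : |(w.1 l : ℝ) * f w.2| ≤ C * ‖w.1‖ ^ 1 := by
  rw [abs_mul, pow_one, mul_comm C]
  exact mul_le_mul (abs_intCast_apply_le _ _) (hC _) (abs_nonneg _) (norm_nonneg _)

lemma abs_intCast_mul_intCast_le {S : Type*} (l m : Fin d) (w : (Fin d → ℤ) × S) :
    |(w.1 l : ℝ) * (w.1 m : ℝ)| ≤ 1 * ‖w.1‖ ^ 2 := by
  rw [abs_mul, one_mul, pow_two]
  exact mul_le_mul (abs_intCast_apply_le _ _) (abs_intCast_apply_le _ _) (abs_nonneg _)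
    (norm_nonneg _)

lemma measurable_intCast_apply (l : Fin d) :
    Measurable fun w : (Fin d → ℤ) × S => (w.1 l : ℝ) :=
  (measurable_of_countable fun y : Fin d → ℤ => (y l : ℝ)).comp measurable_fst

lemma momentOne_eq (hmom : HasFiniteMoments P) {f : S → ℝ} (hf : Measurable f) {C : ℝ}
    (hC : ∀ u, |f u| ≤ C) (l : Fin d) (u : S) :
    momentOne P l f u = ∫ w, (w.1 l : ℝ) * f w.2 ∂(jumpKernel P u) := by
  have hm : Measurable fun w : (Fin d → ℤ) × S => (w.1 l : ℝ) * f w.2 :=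
    (measurable_intCast_apply l).mul (hf.comp measurable_snd)
  rw [integral_jumpKernel u hm (hmom.integrable_of_le hm (abs_intCast_mul_le hC l) u), momentOne]
  simp_rw [integral_const_mul]

lemma momentTwo_one_eq (hmom : HasFiniteMoments P) (l m : Fin d) (u : S) :
    momentTwo P l m (fun _ => 1) u = ∫ w, (w.1 l : ℝ) * (w.1 m : ℝ) ∂(jumpKernel P u) := by
  have hm : Measurable fun w : (Fin d → ℤ) × S => (w.1 l : ℝ) * (w.1 m : ℝ) :=
    (measurable_intCast_apply l).mul (measurable_intCast_apply m)
  rw [integral_jumpKernel u hm (hmom.integrable_of_le hm (abs_intCast_mul_intCast_le l m) u),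
    momentTwo]
  congr 1
  ext1 y
  simp [mul_comm]

end Moments

/-! ### Correctors and the asymptotic covariance -/

section Correctors

variable {d : ℕ} {S : Type*} [MeasurableSpace S] {P : (Fin d → ℤ) → Kernel S S}
  [IsMarkovKernel (Kernel.sum P)] {ρ : Measure S} [IsProbabilityMeasure ρ]

/-- Absence of drift is the solvability condition, so the default value 0 in `invSubOne` does not
occur. -/
lemma isCenteredSolution_invSubOne (hmom : HasFiniteMoments P)
    (hgap : HasSpectralGap (Kernel.sum P)) (hρ : (Kernel.sum P).Invariant ρ)
    (hdrift : ∀ l : Fin d, ∫ u, momentOne P l (fun _ => 1) u ∂ρ = 0) (l : Fin d) :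
    IsCenteredSolution (Kernel.sum P) ρ (momentOne P l (fun _ => 1))
      (invSubOne (Kernel.sum P) ρ (momentOne P l (fun _ => 1))) := by
  have h1 : ∀ _ : S, |(1 : ℝ)| ≤ 1 := fun _ => by simp
  obtain ⟨D, hD⟩ := hmom.exists_abs_integral_le zero_le_one (abs_intCast_mul_le h1 l)
  have heq := momentOne_eq hmom measurable_const h1 l
  have hex : ∃ f, IsCenteredSolution (Kernel.sum P) ρ (momentOne P l (fun _ => 1)) f := by
    refine hgap.exists_isCenteredSolution hρ ?_ (C := D) (fun u => ?_) (hdrift l)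
    · rw [funext heq]
      exact measurable_integral_jumpKernel ((measurable_intCast_apply l).mul measurable_const)
    · rw [heq]
      exact hD u
  rw [invSubOne, dif_pos hex]
  exact hex.choose_spec

open scoped Matrix in
/-- First and second order correctors for the function `exp (i ε ⟨θ, x⟩)`. -/
lemma exists_correctors (hmom : HasFiniteMoments P)
    (hgap : HasSpectralGap (Kernel.sum P)) (hρ : (Kernel.sum P).Invariant ρ)
    (hdrift : ∀ l : Fin d, ∫ u, momentOne P l (fun _ => 1) u ∂ρ = 0) (θ : Fin d → ℝ) :
    ∃ (a b : S → ℝ) (A B : ℝ), Measurable a ∧ Measurable b ∧ (∀ u, |a u| ≤ A) ∧ (∀ u, |b u| ≤ B) ∧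
      (∀ u, ∫ w, (displacement θ w.1 + a w.2) ∂(jumpKernel P u) = a u) ∧
      (∀ u, ∫ w, (displacement θ w.1 ^ 2 / 2 + displacement θ w.1 * a w.2 - b w.2)
        ∂(jumpKernel P u) = θ ⬝ᵥ asymptoticCov P ρ *ᵥ θ / 2 - b u) := by
  set f : Fin d → S → ℝ := fun l => invSubOne (Kernel.sum P) ρ (momentOne P l (fun _ => 1)) with hf
  have hsol : ∀ l, IsCenteredSolution (Kernel.sum P) ρ (momentOne P l (fun _ => 1)) (f l) :=
    isCenteredSolution_invSubOne hmom hgap hρ hdrift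
  choose A hA using fun l => (hsol l).bounded
  have h1 : ∀ _ : S, |(1 : ℝ)| ≤ 1 := fun _ => by simp
  -- With this sign, Qa - a cancels the mean displacement in direction θ, which is the term of order
  -- ε.
  set a : S → ℝ := fun u => -∑ l, θ l * f l u with ha
  have ham : Measurable a :=
    (Finset.measurable_fun_sum _ fun l _ => (hsol l).measurable.const_mul _).neg
  have hab : ∀ u, |a u| ≤ ∑ l, |θ l| * A l := by
    intro u
    rw [ha, abs_neg]
    refine (Finset.abs_sum_le_sum_abs _ _).trans (Finset.sum_le_sum fun l _ => ?_)
    rw [abs_mul]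
    gcongr
    exact hA l u
  -- The integrand whose average over one jump and over ρ is σ_{lm}. The second order term, before
  -- its correction by `b`, is half the quadratic form of `ψ` in θ.
  let ψ : Fin d → Fin d → (Fin d → ℤ) × S → ℝ := fun l m w =>
    (w.1 l : ℝ) * (w.1 m : ℝ) - (w.1 l : ℝ) * f m w.2 - (w.1 m : ℝ) * f l w.2
  have hm2 : ∀ l m, Measurable fun w : (Fin d → ℤ) × S => (w.1 l : ℝ) * (w.1 m : ℝ) := fun l m =>
    (measurable_intCast_apply l).mul (measurable_intCast_apply m)
  have hm1 : ∀ l m, Measurable fun w : (Fin d → ℤ) × S => (w.1 l : ℝ) * f m w.2 := fun l m =>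
    (measurable_intCast_apply l).mul ((hsol m).measurable.comp measurable_snd)
  have hi2 := fun l m u => hmom.integrable_of_le (hm2 l m) (abs_intCast_mul_intCast_le l m) u
  have hi1 := fun l m u => hmom.integrable_of_le (hm1 l m) (abs_intCast_mul_le (hA m) l) u
  have hψ : ∀ l m u, Integrable (ψ l m) (jumpKernel P u) := fun l m u =>
    ((hi2 l m u).sub (hi1 l m u)).sub (hi1 m l u)
  have hA0 : ∀ l, 0 ≤ A l := fun l =>
    (abs_nonneg _).trans (hA l (nonempty_of_isProbabilityMeasure ρ).some)
  have hr : ∀ {φ : (Fin d → ℤ) × S → ℝ}, Measurable φ → ∀ {C : ℝ} {k : ℕ}, 0 ≤ C →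
      (∀ w, |φ w| ≤ C * ‖w.1‖ ^ k) → Integrable (fun u => ∫ w, φ w ∂(jumpKernel P u)) ρ := by
    intro φ hφ C k hC h
    obtain ⟨D, hD⟩ := hmom.exists_abs_integral_le hC h
    exact Integrable.of_bound (measurable_integral_jumpKernel hφ).aestronglyMeasurable D
      (ae_of_all _ hD)
  have hr2 := fun l m => hr (hm2 l m) zero_le_one (abs_intCast_mul_intCast_le l m)
  have hr1 := fun l m => hr (hm1 l m) (hA0 m) (abs_intCast_mul_le (hA m) l)
  have hψe : ∀ l m u, ∫ w, ψ l m w ∂(jumpKernel P u) =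
      ∫ w, (w.1 l : ℝ) * (w.1 m : ℝ) ∂(jumpKernel P u) -
        ∫ w, (w.1 l : ℝ) * f m w.2 ∂(jumpKernel P u) -
        ∫ w, (w.1 m : ℝ) * f l w.2 ∂(jumpKernel P u) := fun l m u => by
    have h21 : Integrable (fun w => (w.1 l : ℝ) * (w.1 m : ℝ) - (w.1 l : ℝ) * f m w.2)
      (jumpKernel P u) := (hi2 l m u).sub (hi1 l m u)
    rw [← integral_sub (hi2 l m u) (hi1 l m u), ← integral_sub h21 (hi1 m l u)]
  have hψρ : ∀ l m, Integrable (fun u => ∫ w, ψ l m w ∂(jumpKernel P u)) ρ := fun l m => by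
    simp_rw [hψe]
    exact ((hr2 l m).sub (hr1 l m)).sub (hr1 m l)
  have hcov : ∀ l m, asymptoticCov P ρ l m = ∫ u, ∫ w, ψ l m w ∂(jumpKernel P u) ∂ρ := by
    intro l m
    have h21 : Integrable (fun u => ∫ w, (w.1 l : ℝ) * (w.1 m : ℝ) ∂(jumpKernel P u) -
        ∫ w, (w.1 l : ℝ) * f m w.2 ∂(jumpKernel P u)) ρ := (hr2 l m).sub (hr1 l m)
    simp_rw [hψe]
    rw [integral_sub h21 (hr1 m l), integral_sub (hr2 l m) (hr1 l m)]
    simp only [asymptoticCov, Matrix.of_apply]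
    simp_rw [momentTwo_one_eq hmom]
    rw [integral_congr_ae (ae_of_all _ (momentOne_eq hmom (hsol m).measurable (hA m) l)),
      integral_congr_ae (ae_of_all _ (momentOne_eq hmom (hsol l).measurable (hA l) m))]
  have hpt : ∀ w : (Fin d → ℤ) × S, displacement θ w.1 ^ 2 / 2 + displacement θ w.1 * a w.2 =
      (∑ l, ∑ m, θ l * θ m * ψ l m w) / 2 := by
    intro w
    have e1 : ∑ l, ∑ m, θ l * θ m * ((w.1 l : ℝ) * (w.1 m : ℝ)) = displacement θ w.1 ^ 2 := by
      rw [displacement, pow_two, Finset.sum_mul_sum]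
      exact Finset.sum_congr rfl fun l _ => Finset.sum_congr rfl fun m _ => by ring
    have e2 : ∑ l, ∑ m, θ l * θ m * ((w.1 l : ℝ) * f m w.2) = -(displacement θ w.1 * a w.2) := by
      rw [displacement, ha, mul_neg, neg_neg, Finset.sum_mul_sum]
      exact Finset.sum_congr rfl fun l _ => Finset.sum_congr rfl fun m _ => by ring
    have e3 : ∑ l, ∑ m, θ l * θ m * ((w.1 m : ℝ) * f l w.2) = -(displacement θ w.1 * a w.2) := by
      rw [← e2, Finset.sum_comm]
      exact Finset.sum_congr rfl fun l _ => Finset.sum_congr rfl fun m _ => by ring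
    simp only [ψ, mul_sub, Finset.sum_sub_distrib, e1, e2, e3]
    ring
  have hint : ∀ u, Integrable (fun w => displacement θ w.1 ^ 2 / 2 + displacement θ w.1 * a w.2)
      (jumpKernel P u) := fun u => by
    simp_rw [hpt]
    exact (integrable_finsetSum _ fun l _ => integrable_finsetSum _ fun m _ =>
      (hψ l m u).const_mul _).div_const 2
  have hsum : ∀ u, ∫ w, (displacement θ w.1 ^ 2 / 2 + displacement θ w.1 * a w.2)
      ∂(jumpKernel P u) = (∑ l, ∑ m, θ l * θ m * ∫ w, ψ l m w ∂(jumpKernel P u)) / 2 := fun u => by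
    simp_rw [hpt]
    rw [integral_div, integral_finsetSum _ fun l _ => integrable_finsetSum _ fun m _ =>
      (hψ l m u).const_mul _]
    congr 1
    refine Finset.sum_congr rfl fun l _ => ?_
    rw [integral_finsetSum _ fun m _ => (hψ l m u).const_mul _]
    exact Finset.sum_congr rfl fun m _ => integral_const_mul _ _
  set s : ℝ := θ ⬝ᵥ asymptoticCov P ρ *ᵥ θ with hs
  have hmean : ∫ u, ∫ w, (displacement θ w.1 ^ 2 / 2 + displacement θ w.1 * a w.2)
      ∂(jumpKernel P u) ∂ρ = s / 2 := by
    simp_rw [hsum]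
    rw [integral_div, integral_finsetSum _ fun l _ => integrable_finsetSum _ fun m _ =>
      (hψρ l m).const_mul _]
    congr 1
    rw [hs, dotProduct]
    refine Finset.sum_congr rfl fun l _ => ?_
    rw [integral_finsetSum _ fun m _ => (hψρ l m).const_mul _, Matrix.mulVec, dotProduct,
      Finset.mul_sum]
    refine Finset.sum_congr rfl fun m _ => ?_
    rw [integral_const_mul, hcov]
    ring
  have hJm : Measurable fun u => ∫ w, (displacement θ w.1 ^ 2 / 2 + displacement θ w.1 * a w.2)
      ∂(jumpKernel P u) := measurable_integral_jumpKernel (by fun_prop)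
  obtain ⟨D, hD⟩ : ∃ D, ∀ u, |∫ w, (displacement θ w.1 ^ 2 / 2 + displacement θ w.1 * a w.2)
      ∂(jumpKernel P u)| ≤ D := by
    choose D hD using fun l m => hmom.exists_abs_integral_le zero_le_one
      (abs_intCast_mul_intCast_le (S := S) l m)
    choose D' hD' using fun l m => hmom.exists_abs_integral_le (hA0 m)
      (abs_intCast_mul_le (hA m) l)
    refine ⟨(∑ l, ∑ m, |θ l * θ m| * (D l m + D' l m + D' m l)) / 2, fun u => ?_⟩
    rw [hsum, abs_div, abs_two]
    gcongr
    refine (Finset.abs_sum_le_sum_abs _ _).trans (Finset.sum_le_sum fun l _ =>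
      (Finset.abs_sum_le_sum_abs _ _).trans (Finset.sum_le_sum fun m _ => ?_))
    rw [abs_mul, hψe]
    gcongr
    have := abs_le.1 (hD l m u)
    have := abs_le.1 (hD' l m u)
    have := abs_le.1 (hD' m l u)
    rw [abs_le]
    constructor <;> linarith
  -- The second order term depends on the internal state and has mean s / 2; the corrector `b`
  -- absorbs its fluctuation.
  obtain ⟨b, hb⟩ := hgap.exists_isCenteredSolution hρ
    (g := fun u => ∫ w, (displacement θ w.1 ^ 2 / 2 + displacement θ w.1 * a w.2)
      ∂(jumpKernel P u) - s / 2) (hJm.sub_const _) (C := D + |s / 2|)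
    (fun u => (abs_sub _ _).trans (by gcongr; exact hD u))
    (by
      rw [integral_sub (Integrable.of_bound hJm.aestronglyMeasurable D (ae_of_all _ hD))
        (integrable_const _), hmean]
      simp)
  obtain ⟨B, hB⟩ := hb.bounded
  have hbdd : ∀ {g : S → ℝ}, Measurable g → ∀ {C : ℝ}, (∀ u, |g u| ≤ C) → ∀ u,
      Integrable (fun w => g w.2) (jumpKernel P u) := fun hg C hC u =>
    Integrable.of_bound (hg.comp measurable_snd).aestronglyMeasurable C (ae_of_all _ fun w => hC _)
  refine ⟨a, b, _, B, ham, hb.measurable, hab, hB, fun u => ?_, fun u => ?_⟩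
  · have hl : ∀ l, Integrable (fun w : (Fin d → ℤ) × S => θ l * (w.1 l : ℝ)) (jumpKernel P u) :=
      fun l => by
        have := hmom.integrable_of_le ((measurable_intCast_apply l).mul measurable_const)
          (abs_intCast_mul_le h1 l) u
        simpa using this.const_mul (θ l)
    have hd : Integrable (fun w : (Fin d → ℤ) × S => displacement θ w.1) (jumpKernel P u) :=
      integrable_finsetSum _ fun l _ => hl l
    rw [integral_add hd (hbdd ham hab u), integral_comp_snd_jumpKernel u ham.stronglyMeasurable]
    have e1 : ∫ w, displacement θ w.1 ∂(jumpKernel P u) =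
        ∑ l, θ l * momentOne P l (fun _ => 1) u := by
      simp only [displacement]
      rw [integral_finsetSum _ fun l _ => hl l]
      refine Finset.sum_congr rfl fun l _ => ?_
      rw [integral_const_mul, momentOne_eq hmom measurable_const h1]
      simp
    have e2 : ∫ v, a v ∂(Kernel.sum P u) = -∑ l, θ l * ∫ v, f l v ∂(Kernel.sum P u) := by
      rw [ha, integral_neg, integral_finsetSum]
      · simp_rw [integral_const_mul]
      · exact fun l _ => (Integrable.of_bound (hsol l).measurable.aestronglyMeasurable (A l)
          (ae_of_all _ (hA l))).const_mul _
    rw [e1, e2, ← sub_eq_add_neg, ← Finset.sum_sub_distrib]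
    change _ = -∑ l, θ l * f l u
    rw [← Finset.sum_neg_distrib]
    refine Finset.sum_congr rfl fun l _ => ?_
    rw [← (hsol l).solves u]
    ring
  · have := hb.solves u
    rw [integral_sub (hint u) (hbdd hb.measurable hB u),
      integral_comp_snd_jumpKernel u hb.measurable.stronglyMeasurable]
    linarith

end Correctors

/-! ### Taylor bounds for the imaginary exponential -/

/-- The bound has to hold for all real x because jumps may be unbounded: for |x| ≤ 1 it comes from
the series, for |x| ≥ 1 from |x| ≤ |x|². -/
lemma norm_exp_I_mul_sub_one_sub_le (x : ℝ) :
    ‖Complex.exp (Complex.I * x) - 1 - Complex.I * x‖ ≤ 3 * |x| ^ 2 := by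
  rcases le_total |x| 1 with h | h
  · have h1 := Complex.norm_exp_sub_one_sub_id_le (x := Complex.I * x) (by simpa using h)
    have h2 : ‖Complex.I * (x : ℂ)‖ = |x| := by simp
    rw [h2] at h1
    nlinarith [sq_nonneg |x|]
  · have h1 : ‖Complex.exp (Complex.I * x) - 1‖ ≤ |x| := Real.norm_exp_I_mul_ofReal_sub_one_le
    have h2 : ‖Complex.I * (x : ℂ)‖ = |x| := by simp
    have := norm_sub_le (Complex.exp (Complex.I * x) - 1) (Complex.I * x)
    nlinarith

lemma norm_exp_I_mul_sub_taylor_two_le (x : ℝ) :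
    ‖Complex.exp (Complex.I * x) - 1 - Complex.I * x + x ^ 2 / 2‖ ≤ 4 * |x| ^ 3 := by
  have h2 : ‖Complex.I * (x : ℂ)‖ = |x| := by simp
  rcases le_total |x| 1 with h | h
  · have h1 := Complex.exp_bound (x := Complex.I * x) (by simpa using h) (n := 3) (by norm_num)
    have h3 : ∑ m ∈ Finset.range 3, (Complex.I * (x : ℂ)) ^ m / (m.factorial : ℂ) =
        1 + Complex.I * x - x ^ 2 / 2 := by
      simp [Finset.sum_range_succ, mul_pow, Nat.factorial]
      ring
    rw [h3, h2] at h1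
    have h4 : Complex.exp (Complex.I * x) - 1 - Complex.I * x + x ^ 2 / 2 =
        Complex.exp (Complex.I * x) - (1 + Complex.I * x - x ^ 2 / 2) := by ring
    rw [h4]
    refine h1.trans ?_
    rw [mul_comm]
    gcongr
    norm_num [Nat.factorial]
  · have h1 := norm_exp_I_mul_sub_one_sub_le x
    have h3 : ‖((x : ℂ) ^ 2 / 2)‖ = |x| ^ 2 / 2 := by simp
    have := norm_add_le (Complex.exp (Complex.I * x) - 1 - Complex.I * x) ((x : ℂ) ^ 2 / 2)
    have : |x| ^ 2 ≤ |x| ^ 3 := pow_le_pow_right₀ h (by norm_num)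
    have : 0 ≤ |x| ^ 3 := by positivity
    linarith

/-! ### Plane waves -/

section PlaneWave

variable {d : ℕ} {S : Type*} [MeasurableSpace S] {P : (Fin d → ℤ) → Kernel S S}

/-- The plane wave `exp (i ε ⟨θ, x⟩) f(v)` with amplitude `f` depending on the internal state. -/
noncomputable def planeWave (θ : Fin d → ℝ) (ε : ℝ) (f : BddMeas S) :
    BddMeas ((Fin d → ℤ) × S) :=
  BddMeas.ofBound (fun z => Complex.exp (Complex.I * (ε * displacement θ z.1 : ℝ)) * f z.2)
    (by
      have := BddMeas.measurable f
      have h1 : Measurable fun z : (Fin d → ℤ) × S => displacement θ z.1 := by fun_prop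
      have h2 : Measurable fun z : (Fin d → ℤ) × S => f z.2 := this.comp measurable_snd
      have h3 : Measurable fun z : (Fin d → ℤ) × S =>
        Complex.exp (Complex.I * (ε * displacement θ z.1 : ℝ)) := by fun_prop
      exact h3.mul h2) ‖f‖
    (fun z => by
      rw [norm_mul, Complex.norm_exp_I_mul_ofReal, one_mul]
      exact BddMeas.norm_le f z.2)

lemma planeWave_apply (θ : Fin d → ℝ) (ε : ℝ) (f : BddMeas S) (x : Fin d → ℤ) (v : S) :
    planeWave θ ε f (x, v) = Complex.exp (Complex.I * (ε * displacement θ x : ℝ)) * f v := rfl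

lemma norm_planeWave_le (θ : Fin d → ℝ) (ε : ℝ) (f : BddMeas S) : ‖planeWave θ ε f‖ ≤ ‖f‖ :=
  BddMeas.norm_le_of_forall_le (norm_nonneg f) fun z => by
    obtain ⟨x, v⟩ := z
    rw [planeWave_apply, norm_mul, Complex.norm_exp_I_mul_ofReal, one_mul]
    exact BddMeas.norm_le f v

lemma planeWave_sub (θ : Fin d → ℝ) (ε : ℝ) (f g : BddMeas S) :
    planeWave θ ε (f - g) = planeWave θ ε f - planeWave θ ε g := by
  ext ⟨x, v⟩
  rw [BddMeas.sub_apply, planeWave_apply, planeWave_apply, planeWave_apply, BddMeas.sub_apply]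
  ring

lemma planeWave_add (θ : Fin d → ℝ) (ε : ℝ) (f g : BddMeas S) :
    planeWave θ ε (f + g) = planeWave θ ε f + planeWave θ ε g := by
  ext ⟨x, v⟩
  rw [BddMeas.add_apply, planeWave_apply, planeWave_apply, planeWave_apply, BddMeas.add_apply]
  ring

lemma planeWave_smul (θ : Fin d → ℝ) (ε : ℝ) (c : ℂ) (f : BddMeas S) :
    planeWave θ ε (c • f) = c • planeWave θ ε f := by
  ext ⟨x, v⟩
  rw [BddMeas.smul_apply, planeWave_apply, planeWave_apply, BddMeas.smul_apply]
  ring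

variable [IsMarkovKernel (Kernel.sum P)]

/-- Translation invariance: the phase at `x` factors out, and the step acts on the amplitude alone.
-/
lemma kernelOp_stepKernel_planeWave (θ : Fin d → ℝ) (ε : ℝ) (f : BddMeas S) (x : Fin d → ℤ)
    (v : S) :
    kernelOp (stepKernel P) (planeWave θ ε f) (x, v) =
      Complex.exp (Complex.I * (ε * displacement θ x : ℝ)) *
        ∫ w, planeWave θ ε f w ∂(jumpKernel P v) := by
  rw [kernelOp_stepKernel_apply, ← integral_const_mul]
  congr 1
  ext1 w
  obtain ⟨y, v'⟩ := w
  rw [planeWave_apply, planeWave_apply, ← mul_assoc, ← Complex.exp_add, displacement_add]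
  congr 2
  push_cast
  ring

/-- If the action of the step operator on the amplitude is close to multiplication with `c`, then
the plane wave is an approximate eigenfunction. -/
lemma norm_kernelOp_stepKernel_planeWave_sub_le (θ : Fin d → ℝ) (ε : ℝ) (f g : BddMeas S) {K : ℝ}
    (hK : 0 ≤ K) (h : ∀ v, ‖∫ w, planeWave θ ε f w ∂(jumpKernel P v) - g v‖ ≤ K) :
    ‖kernelOp (stepKernel P) (planeWave θ ε f) - planeWave θ ε g‖ ≤ K := by
  refine BddMeas.norm_le_of_forall_le hK fun z => ?_
  obtain ⟨x, v⟩ := z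
  rw [BddMeas.sub_apply, kernelOp_stepKernel_planeWave, planeWave_apply, ← mul_sub, norm_mul,
    Complex.norm_exp_I_mul_ofReal, one_mul]
  exact h v

/-- For slowly varying plane waves the step operator acts on the amplitude like `Q`. -/
lemma HasFiniteMoments.exists_norm_planeWave_sub_le (hmom : HasFiniteMoments P) (θ : Fin d → ℝ)
    (f : BddMeas S) : ∃ K : ℝ, 0 ≤ K ∧ ∀ ε : ℝ, 0 ≤ ε →
      ‖kernelOp (stepKernel P) (planeWave θ ε f) - planeWave θ ε (kernelOp (Kernel.sum P) f)‖ ≤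
        ε * K := by
  obtain ⟨C, hC⟩ := hmom.exists_integral_displacement_pow_le θ 1
  refine ⟨‖f‖ * |C|, by positivity, fun ε hε => ?_⟩
  refine norm_kernelOp_stepKernel_planeWave_sub_le θ ε f _ (by positivity) fun v => ?_
  have hs : StronglyMeasurable fun v => f v := (BddMeas.measurable f).stronglyMeasurable
  have hi : Integrable (fun w : (Fin d → ℤ) × S => f w.2) (jumpKernel P v) :=
    Integrable.of_bound (hs.comp_measurable measurable_snd).aestronglyMeasurable ‖f‖
      (ae_of_all _ fun w => BddMeas.norm_le f w.2)
  rw [kernelOp_apply, ← integral_comp_snd_jumpKernel v hs,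
    ← integral_sub (BddMeas.integrable _ _) hi]
  refine (norm_integral_le_of_norm_le ((hC v).1.const_mul (ε * ‖f‖))
    (ae_of_all _ fun w => ?_)).trans ?_
  · obtain ⟨y, v'⟩ := w
    have h1 : planeWave θ ε f (y, v') - f v' =
        (Complex.exp (Complex.I * (ε * displacement θ y : ℝ)) - 1) * f v' := by
      rw [planeWave_apply]
      ring
    rw [h1, norm_mul, pow_one]
    have h2 : ‖Complex.exp (Complex.I * (ε * displacement θ y : ℝ)) - 1‖ ≤
        ε * |displacement θ y| := by
      refine Real.norm_exp_I_mul_ofReal_sub_one_le.trans ?_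
      rw [Real.norm_eq_abs, abs_mul, abs_of_nonneg hε]
    calc _ ≤ ε * |displacement θ y| * ‖f‖ := by
          gcongr
          exact BddMeas.norm_le f v'
      _ = _ := by ring
  · rw [integral_const_mul, mul_assoc]
    gcongr
    exact (hC v).2.trans (le_abs_self C)

/-- The coefficients 1, iεa and ε²b of the amplitude are paired with the Taylor remainders of
exp(iεw) of order three, two and one, so that every product is O(ε³). -/
lemma norm_planeWave_remainder_le {ε a b w A B : ℝ} (hε : 0 ≤ ε) (ha : |a| ≤ A) (hb : |b| ≤ B) :
    ‖Complex.exp (Complex.I * (ε * w : ℝ)) * (1 + Complex.I * (ε * a) + ε ^ 2 * b) -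
      (1 + Complex.I * ε * (w + a : ℝ) - ε ^ 2 * (w ^ 2 / 2 + w * a - b : ℝ))‖ ≤
      ε ^ 3 * (4 * |w| ^ 3 + 3 * A * |w| ^ 2 + B * |w| ^ 1) := by
  set E := Complex.exp (Complex.I * (ε * w : ℝ)) with hE
  have h0 : |ε * w| = ε * |w| := by rw [abs_mul, abs_of_nonneg hε]
  have h1 := norm_exp_I_mul_sub_taylor_two_le (ε * w)
  have h2 := norm_exp_I_mul_sub_one_sub_le (ε * w)
  have h3 : ‖E - 1‖ ≤ |ε * w| := Real.norm_exp_I_mul_ofReal_sub_one_le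
  rw [← hE, h0] at h1 h2
  rw [h0] at h3
  have h4 : E * (1 + Complex.I * (ε * a) + ε ^ 2 * b) -
      (1 + Complex.I * ε * (w + a : ℝ) - ε ^ 2 * (w ^ 2 / 2 + w * a - b : ℝ)) =
      (E - 1 - Complex.I * (ε * w : ℝ) + ((ε * w : ℝ) : ℂ) ^ 2 / 2) +
      (Complex.I * (ε * a)) * (E - 1 - Complex.I * (ε * w : ℝ)) + (ε ^ 2 * b) * (E - 1) := by
    push_cast
    linear_combination ((ε : ℂ) ^ 2 * w * a) * Complex.I_sq
  have n1 : ‖Complex.I * ((ε : ℂ) * a)‖ = ε * |a| := by simp [abs_of_nonneg hε]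
  have n2 : ‖((ε : ℂ) ^ 2 * b)‖ = ε ^ 2 * |b| := by simp [abs_of_nonneg hε]
  rw [h4]
  refine (norm_add₃_le).trans ?_
  rw [norm_mul (Complex.I * ((ε : ℂ) * a)), norm_mul ((ε : ℂ) ^ 2 * b), n1, n2]
  have hA : 0 ≤ A := (abs_nonneg a).trans ha
  have hB : 0 ≤ B := (abs_nonneg b).trans hb
  calc _ ≤ 4 * (ε * |w|) ^ 3 + ε * A * (3 * (ε * |w|) ^ 2) + ε ^ 2 * B * (ε * |w|) := by gcongr
    _ = _ := by ring

open scoped Matrix in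
/-- Plane waves with suitably corrected amplitude are approximate eigenfunctions of the step
operator, up to an error of third order. -/
lemma exists_approximate_eigenfunction {ρ : Measure S} [IsProbabilityMeasure ρ]
    (hmom : HasFiniteMoments P)
    (hgap : HasSpectralGap (Kernel.sum P)) (hρ : (Kernel.sum P).Invariant ρ)
    (hdrift : ∀ l : Fin d, ∫ u, momentOne P l (fun _ => 1) u ∂ρ = 0) (θ : Fin d → ℝ) :
    ∃ K : ℝ, 0 ≤ K ∧ ∀ ε : ℝ, 0 ≤ ε → ε ≤ 1 → ∃ f : BddMeas S,
      (∀ v, ‖f v - 1‖ ≤ ε * K) ∧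
      ‖kernelOp (stepKernel P) (planeWave θ ε f) - planeWave θ ε f -
        ((-(ε ^ 2 * (θ ⬝ᵥ asymptoticCov P ρ *ᵥ θ) / 2) : ℝ) : ℂ) • planeWave θ ε f‖ ≤ ε ^ 3 * K := by
  obtain ⟨a, b, A, B, ham, hbm, hA, hB, h1, h2⟩ := exists_correctors hmom hgap hρ hdrift θ
  set s := θ ⬝ᵥ asymptoticCov P ρ *ᵥ θ with hs
  have hA0 : 0 ≤ A := (abs_nonneg _).trans (hA (nonempty_of_isProbabilityMeasure ρ).some)
  have hB0 : 0 ≤ B := (abs_nonneg _).trans (hB (nonempty_of_isProbabilityMeasure ρ).some)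
  obtain ⟨C1, hC1⟩ := hmom.exists_integral_displacement_pow_le θ 1
  obtain ⟨C2, hC2⟩ := hmom.exists_integral_displacement_pow_le θ 2
  obtain ⟨C3, hC3⟩ := hmom.exists_integral_displacement_pow_le θ 3
  set D : ℝ := 4 * |C3| + 3 * A * |C2| + B * |C1| + (A + B) * |s| with hD
  refine ⟨A + B + D, by positivity, fun ε hε hε1 => ?_⟩
  have hfb : ∀ v, ‖Complex.I * (ε * a v) + ε ^ 2 * b v‖ ≤ ε * (A + B) := by
    intro v
    refine (norm_add_le _ _).trans ?_
    have n1 : ‖Complex.I * ((ε : ℂ) * a v)‖ = ε * |a v| := by simp [abs_of_nonneg hε]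
    have n2 : ‖((ε : ℂ) ^ 2 * b v)‖ = ε ^ 2 * |b v| := by simp [abs_of_nonneg hε]
    rw [n1, n2, mul_add]
    have : ε ^ 2 ≤ ε := by nlinarith
    gcongr
    · exact hA v
    · exact hB v
  let f : BddMeas S := BddMeas.ofBound (fun v => 1 + Complex.I * (ε * a v) + ε ^ 2 * b v)
    (by fun_prop) (1 + ε * (A + B)) (fun v => by
      rw [add_assoc]
      exact (norm_add_le _ _).trans (by rw [norm_one]; gcongr; exact hfb v))
  have hfv : ∀ v, f v = 1 + Complex.I * (ε * a v) + ε ^ 2 * b v := fun v => rfl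
  refine ⟨f, fun v => ?_, ?_⟩
  · rw [hfv, add_assoc, add_sub_cancel_left]
    refine (hfb v).trans ?_
    have : 0 ≤ D := by positivity
    exact mul_le_mul_of_nonneg_left (by linarith) hε
  have hg : kernelOp (stepKernel P) (planeWave θ ε f) - planeWave θ ε f -
      ((-(ε ^ 2 * s / 2) : ℝ) : ℂ) • planeWave θ ε f =
      kernelOp (stepKernel P) (planeWave θ ε f) -
        planeWave θ ε (f + ((-(ε ^ 2 * s / 2) : ℝ) : ℂ) • f) := by
    rw [planeWave_add, planeWave_smul, sub_sub]
  rw [hg]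
  refine norm_kernelOp_stepKernel_planeWave_sub_le θ ε f _ (by positivity) fun v => ?_
  let φ1 : (Fin d → ℤ) × S → ℝ := fun w => displacement θ w.1 + a w.2
  let φ2 : (Fin d → ℤ) × S → ℝ := fun w =>
    displacement θ w.1 ^ 2 / 2 + displacement θ w.1 * a w.2 - b w.2
  have hd1 : Integrable (fun w => displacement θ w.1) (jumpKernel P v) := by
    have := (hC1 v).1
    simp only [pow_one] at this
    exact (integrable_norm_iff (Measurable.aestronglyMeasurable (by fun_prop))).1 this
  have hd2 : Integrable (fun w => displacement θ w.1 ^ 2) (jumpKernel P v) := by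
    simpa using (hC2 v).1
  have hai : Integrable (fun w => a w.2) (jumpKernel P v) :=
    Integrable.of_bound (Measurable.aestronglyMeasurable (by fun_prop)) A
      (ae_of_all _ fun w => hA w.2)
  have hbi : Integrable (fun w => b w.2) (jumpKernel P v) :=
    Integrable.of_bound (Measurable.aestronglyMeasurable (by fun_prop)) B
      (ae_of_all _ fun w => hB w.2)
  have hda : Integrable (fun w => displacement θ w.1 * a w.2) (jumpKernel P v) :=
    hd1.mul_bdd (c := A) (Measurable.aestronglyMeasurable (by fun_prop))
      (ae_of_all _ fun w => hA w.2)
  have hi1 : Integrable φ1 (jumpKernel P v) := hd1.add hai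
  have hi2 : Integrable φ2 (jumpKernel P v) := ((hd2.div_const 2).add hda).sub hbi
  have hc1 : Integrable (fun w => Complex.I * ε * (φ1 w : ℂ)) (jumpKernel P v) :=
    hi1.ofReal.const_mul _
  have hc2 : Integrable (fun w => (ε : ℂ) ^ 2 * (φ2 w : ℂ)) (jumpKernel P v) :=
    hi2.ofReal.const_mul _
  have hi0 : Integrable (fun w => (1 : ℂ) + Complex.I * ε * (φ1 w : ℂ)) (jumpKernel P v) :=
    (integrable_const _).add hc1
  have hiT : Integrable (fun w => (1 : ℂ) + Complex.I * ε * (φ1 w : ℂ) - ε ^ 2 * (φ2 w : ℂ))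
      (jumpKernel P v) := hi0.sub hc2
  have hT : ∫ w, ((1 : ℂ) + Complex.I * ε * (φ1 w : ℝ) - ε ^ 2 * (φ2 w : ℝ)) ∂(jumpKernel P v) =
      1 + Complex.I * ε * a v - ε ^ 2 * ((s / 2 - b v : ℝ) : ℂ) := by
    rw [integral_sub hi0 hc2, integral_add (integrable_const _) hc1, integral_const_mul,
      integral_const_mul, integral_complex_ofReal, integral_complex_ofReal, h1 v, h2 v]
    simp
  have hrem : ‖∫ w, planeWave θ ε f w ∂(jumpKernel P v) -
      (1 + Complex.I * ε * a v - ε ^ 2 * ((s / 2 - b v : ℝ) : ℂ))‖ ≤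
      ε ^ 3 * (4 * |C3| + 3 * A * |C2| + B * |C1|) := by
    rw [← hT, ← integral_sub (BddMeas.integrable _ _) hiT]
    have hb1 : Integrable (fun w => 4 * |displacement θ w.1| ^ 3 + 3 * A * |displacement θ w.1| ^ 2)
      (jumpKernel P v) := ((hC3 v).1.const_mul _).add ((hC2 v).1.const_mul _)
    have hb2 := (hC1 v).1.const_mul B
    refine (norm_integral_le_of_norm_le ((hb1.add hb2).const_mul (ε ^ 3))
      (ae_of_all _ fun w => ?_)).trans ?_
    · exact norm_planeWave_remainder_le hε (hA w.2) (hB w.2)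
    · rw [integral_const_mul]
      simp only [Pi.add_apply]
      rw [integral_add hb1 hb2, integral_add ((hC3 v).1.const_mul _) ((hC2 v).1.const_mul _),
        integral_const_mul, integral_const_mul, integral_const_mul]
      gcongr
      · exact (hC3 v).2.trans (le_abs_self _)
      · exact (hC2 v).2.trans (le_abs_self _)
      · exact (hC1 v).2.trans (le_abs_self _)
  -- The averaged expansion is (1 - ε²s/2) f up to (ε²s/2)(f - 1), which is again of third order.
  have hlast : (1 + Complex.I * ε * a v - ε ^ 2 * ((s / 2 - b v : ℝ) : ℂ)) -
      (f + ((-(ε ^ 2 * s / 2) : ℝ) : ℂ) • f) v =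
      ((ε ^ 2 * s / 2 : ℝ) : ℂ) * (Complex.I * (ε * a v) + ε ^ 2 * b v) := by
    rw [BddMeas.add_apply, BddMeas.smul_apply, hfv]
    push_cast
    ring
  have hsplit := norm_sub_le_norm_sub_add_norm_sub (∫ w, planeWave θ ε f w ∂(jumpKernel P v))
    (1 + Complex.I * ε * a v - ε ^ 2 * ((s / 2 - b v : ℝ) : ℂ))
    ((f + ((-(ε ^ 2 * s / 2) : ℝ) : ℂ) • f) v)
  rw [hlast, norm_mul, Complex.norm_real] at hsplit
  refine hsplit.trans ?_
  have e1 : ‖ε ^ 2 * s / 2‖ * ‖Complex.I * (ε * a v) + ε ^ 2 * b v‖ ≤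
      ε ^ 2 * |s| * (ε * (A + B)) := by
    gcongr
    · rw [Real.norm_eq_abs, abs_div, abs_mul, abs_of_nonneg (sq_nonneg ε), abs_two]
      have : 0 ≤ ε ^ 2 * |s| := by positivity
      linarith
    · exact hfb v
  have e2 : 0 ≤ ε ^ 3 * (A + B) := by positivity
  calc _ ≤ ε ^ 3 * (4 * |C3| + 3 * A * |C2| + B * |C1|) + ε ^ 2 * |s| * (ε * (A + B)) :=
        add_le_add hrem e1
    _ ≤ ε ^ 3 * (A + B + D) := by rw [hD]; nlinarith

end PlaneWave

/-! ### Asymptotics of the semigroup on plane waves -/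

section SemigroupLimit

variable {d : ℕ} {S : Type*} [MeasurableSpace S] {P : (Fin d → ℤ) → Kernel S S}
  [IsMarkovKernel (Kernel.sum P)] {ρ : Measure S} [IsProbabilityMeasure ρ] {lam : ℝ}

lemma norm_stepSemigroup_planeWave_le (hlam : 0 ≤ lam) {t : ℝ} (ht : 0 ≤ t)
    (F : BddMeas ((Fin d → ℤ) × S)) :
    ‖stepSemigroup lam (kernelOp (stepKernel P)) t F‖ ≤ ‖F‖ := by
  simpa using ContinuousLinearMap.le_of_opNorm_le _
    (norm_stepSemigroup_le hlam (norm_kernelOp_le (stepKernel P)) ht) F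

/-- Plane waves whose amplitude has mean zero are forgotten. -/
lemma exists_norm_stepSemigroup_planeWave_centered_le (hlam : 0 < lam) (hmom : HasFiniteMoments P)
    (θ : Fin d → ℝ) (f : BddMeas S) :
    ∃ K : ℝ, ∀ t : ℝ, 1 ≤ t → ‖stepSemigroup lam (kernelOp (stepKernel P)) t
      (planeWave θ (1 / √t) (kernelOp (Kernel.sum P) f - f))‖ ≤ 1 / √t * K := by
  obtain ⟨K, hK0, hK⟩ := hmom.exists_norm_planeWave_sub_le θ f
  refine ⟨1 / √lam * ‖f‖ + K, fun t ht => ?_⟩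
  have ht0 : 0 < t := by linarith
  set T := kernelOp (stepKernel P)
  set ε := 1 / √t with hε
  -- The first bracket lies in the range of T - 1 and is smoothed away; the second is the O(ε) cost
  -- of replacing Q by `T` on a slow wave.
  have h1 : planeWave θ ε (kernelOp (Kernel.sum P) f - f) =
      (T (planeWave θ ε f) - planeWave θ ε f) -
        (T (planeWave θ ε f) - planeWave θ ε (kernelOp (Kernel.sum P) f)) := by
    rw [planeWave_sub]
    abel
  rw [h1, ContinuousLinearMap.map_sub]
  refine (norm_sub_le _ _).trans ?_
  have h2 := norm_stepSemigroup_sub_le hlam (norm_kernelOp_le (stepKernel P)) ht0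
    (planeWave θ ε f)
  have h3 := (norm_stepSemigroup_planeWave_le (P := P) hlam.le ht0.le
    (T (planeWave θ ε f) - planeWave θ ε (kernelOp (Kernel.sum P) f))).trans (hK ε (by positivity))
  have h4 : 1 / √(t * lam) * ‖planeWave θ ε f‖ ≤ ε * (1 / √lam * ‖f‖) := by
    rw [Real.sqrt_mul ht0.le, hε, ← mul_assoc, one_div_mul_one_div]
    gcongr
    exact norm_planeWave_le θ ε f
  rw [mul_add]
  exact add_le_add (h2.trans h4) h3

/-- The constant function `1`. -/
noncomputable def BddMeas.constOne (S : Type*) [MeasurableSpace S] : BddMeas S :=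
  BddMeas.ofBound (fun _ => 1) measurable_const 1 (by simp)

lemma BddMeas.constOne_apply {S : Type*} [MeasurableSpace S] (u : S) : BddMeas.constOne S u = 1 := rfl

set_option maxHeartbeats 2000000 in
open scoped Matrix in
/-- The characteristic function of the displacement converges. -/
lemma exists_norm_stepSemigroup_planeWave_one_sub_le (hlam : 0 < lam) (hmom : HasFiniteMoments P)
    (hgap : HasSpectralGap (Kernel.sum P)) (hρ : (Kernel.sum P).Invariant ρ)
    (hdrift : ∀ l : Fin d, ∫ u, momentOne P l (fun _ => 1) u ∂ρ = 0) (θ : Fin d → ℝ)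
    (hσ : 0 ≤ θ ⬝ᵥ asymptoticCov P ρ *ᵥ θ) (x : Fin d → ℤ) (v : S) :
    ∃ K : ℝ, ∀ t : ℝ, 1 ≤ t → ‖stepSemigroup lam (kernelOp (stepKernel P)) t
      (planeWave θ (1 / √t) (BddMeas.constOne S)) (x, v) -
        Real.exp (-(lam * (θ ⬝ᵥ asymptoticCov P ρ *ᵥ θ) / 2))‖ ≤ 1 / √t * K := by
  obtain ⟨K, hK0, hK⟩ := exists_approximate_eigenfunction hmom hgap hρ hdrift θ
  set s := θ ⬝ᵥ asymptoticCov P ρ *ᵥ θ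
  set E : ℝ := Real.exp (-(lam * s / 2)) with hE
  have hE1 : E ≤ 1 := Real.exp_le_one_iff.2 (by have := mul_nonneg hlam.le hσ; linarith)
  have hE0 : 0 < E := Real.exp_pos _
  refine ⟨K + lam * K + (K + |displacement θ x|), fun t ht => ?_⟩
  have ht0 : 0 < t := by linarith
  have hst : 0 < √t := Real.sqrt_pos.2 ht0
  have hsq : √t ^ 2 = t := Real.sq_sqrt ht0.le
  set ε := 1 / √t with hε
  have hε0 : 0 < ε := by positivity
  have hε1 : ε ≤ 1 := (div_le_one hst).2 (Real.one_le_sqrt.2 ht)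
  have hεt : ε ^ 2 * t = 1 := by rw [hε, div_pow, hsq]; field_simp
  obtain ⟨f, hf1, hf2⟩ := hK ε hε0.le hε1
  set κ : ℝ := -(ε ^ 2 * s / 2) with hκ
  have hκ0 : κ ≤ 0 := by
    have : 0 ≤ ε ^ 2 * s := by positivity
    linarith
  have b1 : ‖stepSemigroup lam (kernelOp (stepKernel P)) t
      (planeWave θ ε (BddMeas.constOne S - f)) (x, v)‖ ≤ ε * K := by
    refine (BddMeas.norm_le _ _).trans ((norm_stepSemigroup_planeWave_le hlam.le ht0.le _).trans
      ((norm_planeWave_le θ ε _).trans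
        (BddMeas.norm_le_of_forall_le (mul_nonneg hε0.le hK0) fun u => ?_)))
    rw [BddMeas.sub_apply, BddMeas.constOne_apply, norm_sub_rev]
    exact hf1 u
  -- As ε²t = 1, the exponent tλκ is exactly -λs/2, and the defect ε³K accumulated over time t is
  -- εK.
  have b2 : ‖(stepSemigroup lam (kernelOp (stepKernel P)) t (planeWave θ ε f) -
      (E : ℂ) • planeWave θ ε f) (x, v)‖ ≤ ε * (lam * K) := by
    have h1 := norm_stepSemigroup_sub_exp_le hlam.le (norm_kernelOp_le (stepKernel P)) hκ0
      (planeWave θ ε f) ht0.le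
    have h2 : t * (lam * κ) = -(lam * s / 2) := by
      rw [hκ]
      linear_combination (-(lam * s / 2)) * hεt
    have h3 : lam * (ε ^ 3 * K) * t = ε * (lam * K) := by
      linear_combination (ε * lam * K) * hεt
    rw [h2] at h1
    refine (BddMeas.norm_le _ _).trans (h1.trans (le_trans ?_ h3.le))
    exact mul_le_mul_of_nonneg_right (mul_le_mul_of_nonneg_left hf2 hlam.le) ht0.le
  -- The phase of the starting point tends to 1 at a rate depending on `x`, so the convergence is
  -- only pointwise in the initial state.
  have b3 : ‖(E : ℂ) * (planeWave θ ε f (x, v) - 1)‖ ≤ ε * (K + |displacement θ x|) := by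
    have h1 : planeWave θ ε f (x, v) - 1 =
        Complex.exp (Complex.I * (ε * displacement θ x : ℝ)) * (f v - 1) +
          (Complex.exp (Complex.I * (ε * displacement θ x : ℝ)) - 1) := by
      rw [planeWave_apply]
      ring
    rw [norm_mul, Complex.norm_real, Real.norm_of_nonneg hE0.le]
    refine (mul_le_of_le_one_left (norm_nonneg _) hE1).trans ?_
    rw [h1, mul_add]
    refine (norm_add_le _ _).trans (add_le_add ?_ ?_)
    · rw [norm_mul, Complex.norm_exp_I_mul_ofReal, one_mul]
      exact hf1 v
    · refine Real.norm_exp_I_mul_ofReal_sub_one_le.trans (le_of_eq ?_)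
      rw [Real.norm_eq_abs, abs_mul, abs_of_pos hε0]
  have htotal : stepSemigroup lam (kernelOp (stepKernel P)) t
        (planeWave θ ε (BddMeas.constOne S)) (x, v) - E =
      stepSemigroup lam (kernelOp (stepKernel P)) t
        (planeWave θ ε (BddMeas.constOne S - f)) (x, v) +
      (stepSemigroup lam (kernelOp (stepKernel P)) t (planeWave θ ε f) -
        (E : ℂ) • planeWave θ ε f) (x, v) + E * (planeWave θ ε f (x, v) - 1) := by
    rw [planeWave_sub, ContinuousLinearMap.map_sub]
    simp only [BddMeas.sub_apply, BddMeas.smul_apply]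
    ring
  rw [htotal, mul_add, mul_add]
  exact norm_add₃_le.trans (add_le_add (add_le_add b1 b2) b3)

-- Split `g` into its mean and a centred part; the latter is in the range of Q - 1 and is forgotten,
-- and the former multiplies the limit for the amplitude 1.
set_option maxHeartbeats 2000000 in
open scoped Matrix in
lemma exists_norm_stepSemigroup_planeWave_sub_le (hlam : 0 < lam) (hmom : HasFiniteMoments P)
    (hgap : HasSpectralGap (Kernel.sum P)) (hρ : (Kernel.sum P).Invariant ρ)
    (hdrift : ∀ l : Fin d, ∫ u, momentOne P l (fun _ => 1) u ∂ρ = 0) (θ : Fin d → ℝ)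
    (hσ : 0 ≤ θ ⬝ᵥ asymptoticCov P ρ *ᵥ θ) (g : BddMeas S) (x : Fin d → ℤ) (v : S) :
    ∃ K : ℝ, ∀ t : ℝ, 1 ≤ t → ‖stepSemigroup lam (kernelOp (stepKernel P)) t
      (planeWave θ (1 / √t) g) (x, v) -
        (∫ u, g u ∂ρ) * Real.exp (-(lam * (θ ⬝ᵥ asymptoticCov P ρ *ᵥ θ) / 2))‖ ≤ 1 / √t * K := by
  set c : ℂ := ∫ u, g u ∂ρ with hc
  obtain ⟨h, hh⟩ := hgap.exists_kernelOp_sub_eq hρ (g - c • BddMeas.constOne S) (by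
    have h1 : ∀ u, (g - c • BddMeas.constOne S) u = g u - c := fun u => by
      rw [BddMeas.sub_apply, BddMeas.smul_apply, BddMeas.constOne_apply, mul_one]
    simp_rw [h1]
    rw [integral_sub (BddMeas.integrable g ρ) (integrable_const c), ← hc]
    simp)
  obtain ⟨K1, hK1⟩ := exists_norm_stepSemigroup_planeWave_centered_le hlam hmom θ h
  obtain ⟨K2, hK2⟩ := exists_norm_stepSemigroup_planeWave_one_sub_le hlam hmom hgap hρ hdrift θ hσ
    x v
  refine ⟨K1 + ‖c‖ * K2, fun t ht => ?_⟩
  specialize hK1 t ht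
  specialize hK2 t ht
  rw [hh] at hK1
  set E : ℝ := Real.exp (-(lam * (θ ⬝ᵥ asymptoticCov P ρ *ᵥ θ) / 2))
  have hg : planeWave θ (1 / √t) g = planeWave θ (1 / √t) (g - c • BddMeas.constOne S) +
      c • planeWave θ (1 / √t) (BddMeas.constOne S) := by
    rw [planeWave_sub, planeWave_smul, sub_add_cancel]
  have htotal : stepSemigroup lam (kernelOp (stepKernel P)) t (planeWave θ (1 / √t) g) (x, v) -
      c * E = stepSemigroup lam (kernelOp (stepKernel P)) t
        (planeWave θ (1 / √t) (g - c • BddMeas.constOne S)) (x, v) +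
      c * (stepSemigroup lam (kernelOp (stepKernel P)) t
        (planeWave θ (1 / √t) (BddMeas.constOne S)) (x, v) - E) := by
    rw [hg, ContinuousLinearMap.map_add, ContinuousLinearMap.map_smul, BddMeas.add_apply,
      BddMeas.smul_apply]
    ring
  rw [htotal, mul_add]
  refine (norm_add_le _ _).trans (add_le_add ((BddMeas.norm_le _ _).trans hK1) ?_)
  rw [norm_mul, mul_left_comm]
  exact mul_le_mul_of_nonneg_left hK2 (norm_nonneg c)

open scoped Matrix in
lemma tendsto_stepSemigroup_planeWave (hlam : 0 < lam) (hmom : HasFiniteMoments P)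
    (hgap : HasSpectralGap (Kernel.sum P)) (hρ : (Kernel.sum P).Invariant ρ)
    (hdrift : ∀ l : Fin d, ∫ u, momentOne P l (fun _ => 1) u ∂ρ = 0) (θ : Fin d → ℝ)
    (hσ : 0 ≤ θ ⬝ᵥ asymptoticCov P ρ *ᵥ θ) (g : BddMeas S) (z : (Fin d → ℤ) × S) :
    Tendsto (fun t : ℝ => stepSemigroup lam (kernelOp (stepKernel P)) t
      (planeWave θ (1 / √t) g) z) atTop
      (𝓝 ((∫ u, g u ∂ρ) * Real.exp (-(lam * (θ ⬝ᵥ asymptoticCov P ρ *ᵥ θ) / 2)))) := by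
  obtain ⟨x, v⟩ := z
  obtain ⟨K, hK⟩ := exists_norm_stepSemigroup_planeWave_sub_le hlam hmom hgap hρ hdrift θ hσ g x v
  have h0 : Tendsto (fun t : ℝ => 1 / √t * K) atTop (𝓝 0) := by
    simpa using (tendsto_const_nhds (x := (1 : ℝ)).div_atTop Real.tendsto_sqrt_atTop).mul_const K
  refine tendsto_iff_norm_sub_tendsto_zero.2 (squeeze_zero' (.of_forall fun _ => norm_nonneg _) ?_
    h0)
  filter_upwards [eventually_ge_atTop 1] with t ht using hK t ht

end SemigroupLimit

/-! ### The law of the walk -/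

/-- The expectation of the Markov property at time 0. -/
lemma IsMarkovProcess.map_eq_bind {Ω E : Type*} [MeasurableSpace Ω] [MeasurableSpace E]
    {p : ℝ≥0 → Kernel E E} {ξ : ℝ≥0 → Ω → E} {μ : Measure Ω} [IsProbabilityMeasure μ]
    [∀ t, IsMarkovKernel (p t)] (h : IsMarkovProcess p ξ μ) (t : ℝ≥0) :
    μ.map (ξ t) = (μ.map (ξ 0)).bind (p t) := by
  ext B hB
  have hm : (⨆ r : Set.Iic (0 : ℝ≥0), MeasurableSpace.comap (ξ r) inferInstance) ≤
      (inferInstance : MeasurableSpace Ω) := iSup_le fun r => (h.measurable r).comap_le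
  have h1 := integral_condExp (μ := μ) hm
    (f := (ξ (0 + t) ⁻¹' B).indicator (fun _ => (1 : ℝ)))
  rw [integral_congr_ae (h.markov 0 t B hB), zero_add,
    integral_indicator_const _ (h.measurable t hB), smul_eq_mul, mul_one] at h1
  have h2 : Measurable fun ω => p t (ξ 0 ω) B :=
    ((p t).measurable_coe hB).comp (h.measurable 0)
  rw [Measure.map_apply (h.measurable t) hB, Measure.bind_apply hB (p t).aemeasurable,
    lintegral_map ((p t).measurable_coe hB) (h.measurable 0)]
  have h3 : ∫⁻ ω, p t (ξ 0 ω) B ∂μ ≠ ∞ := by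
    refine ((lintegral_mono fun ω => prob_le_one).trans_lt ?_).ne
    simp
  rw [← ENNReal.toReal_eq_toReal_iff' (measure_ne_top _ _) h3, ← measureReal_def, ← h1,
    ← integral_toReal h2.aemeasurable (ae_of_all _ fun ω => measure_lt_top _ _)]
  rfl

/-! ### Weak convergence on the product with a circle -/

/-- By Tietze's theorem every bounded continuous test function on `X` extends to `Y`. -/
lemma tendsto_of_isClosedEmbedding_of_tendsto_map {X Y ι : Type*} [TopologicalSpace X]
    [MeasurableSpace X] [BorelSpace X] [TopologicalSpace Y] [NormalSpace Y] [MeasurableSpace Y]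
    [BorelSpace Y] {e : X → Y} (he : IsClosedEmbedding e) {l : Filter ι}
    {ν : ι → ProbabilityMeasure X} {ν₀ : ProbabilityMeasure X}
    (h : Tendsto (fun i => (ν i).map he.continuous.measurable.aemeasurable) l
      (𝓝 (ν₀.map he.continuous.measurable.aemeasurable))) : Tendsto ν l (𝓝 ν₀) := by
  rw [ProbabilityMeasure.tendsto_iff_forall_integral_tendsto] at h ⊢
  intro f
  obtain ⟨g, -, hg⟩ := f.exists_extension_norm_eq_of_isClosedEmbedding he
  have h1 : ∀ (m : ProbabilityMeasure X),
      ∫ y, g y ∂(m.map he.continuous.measurable.aemeasurable : Measure Y) =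
        ∫ x, f x ∂(m : Measure X) := by
    intro m
    rw [ProbabilityMeasure.toMeasure_map, integral_map he.continuous.measurable.aemeasurable
      g.continuous.measurable.aestronglyMeasurable, ← hg]
    rfl
  simpa only [h1] using h g

/-- Lévy's continuity theorem on the product of a Euclidean space with a circle. -/
lemma tendsto_of_tendsto_integral_exp_mul {F : Type*} [NormedAddCommGroup F]
    [InnerProductSpace ℝ F] [FiniteDimensional ℝ F] [MeasurableSpace F] [BorelSpace F]
    {ν : ℕ → ProbabilityMeasure (F × UnitAddCircle)} {ν₀ : ProbabilityMeasure (F × UnitAddCircle)}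
    (h : ∀ (θ : F) (g : C(UnitAddCircle, ℂ)), Tendsto
      (fun n => ∫ z, Complex.exp (inner ℝ z.1 θ * Complex.I) * g z.2
        ∂(ν n : Measure (F × UnitAddCircle))) atTop
      (𝓝 (∫ z, Complex.exp (inner ℝ z.1 θ * Complex.I) * g z.2
        ∂(ν₀ : Measure (F × UnitAddCircle))))) :
    Tendsto ν atTop (𝓝 ν₀) := by
  have hc : IsClosedEmbedding fun v : UnitAddCircle => (AddCircle.toCircle v : ℂ) := by
    refine Continuous.isClosedEmbedding (by fun_prop) ?_
    exact Subtype.val_injective.comp (AddCircle.injective_toCircle one_ne_zero)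
  have he : IsClosedEmbedding fun z : F × UnitAddCircle =>
      WithLp.toLp 2 (z.1, (AddCircle.toCircle z.2 : ℂ)) :=
    (WithLp.homeomorphProd 2 F ℂ).symm.isClosedEmbedding.comp
      (IsClosedEmbedding.id.prodMap hc)
  refine tendsto_of_isClosedEmbedding_of_tendsto_map he
    (ProbabilityMeasure.tendsto_of_tendsto_charFun fun τ => ?_)
  -- A character of F × ℂ restricted to the embedded space is a character of `F` times this
  -- continuous function on the circle, so the hypothesis covers all characteristic functions.
  let g : C(UnitAddCircle, ℂ) :=
    ⟨fun v => Complex.exp (inner ℝ (AddCircle.toCircle v : ℂ) τ.snd * Complex.I), by fun_prop⟩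
  have h1 : ∀ m : ProbabilityMeasure (F × UnitAddCircle),
      charFun (m.map he.continuous.measurable.aemeasurable : Measure (WithLp 2 (F × ℂ))) τ =
        ∫ z, Complex.exp (inner ℝ z.1 τ.fst * Complex.I) * g z.2
          ∂(m : Measure (F × UnitAddCircle)) := by
    intro m
    rw [charFun_apply, ProbabilityMeasure.toMeasure_map,
      integral_map he.continuous.measurable.aemeasurable
        (Measurable.aestronglyMeasurable (by fun_prop))]
    refine integral_congr_ae (ae_of_all _ fun z => ?_)
    simp only [WithLp.prod_inner_apply, g, ContinuousMap.coe_mk]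
    rw [← Complex.exp_add, ← add_mul]
    push_cast
    rfl
  simpa only [h1] using h τ.fst g

/-! ### The limit theorem -/

lemma measurable_rescaled {d : ℕ} {S Ω : Type*} [MeasurableSpace S] [MeasurableSpace Ω]
    {ξ : ℝ≥0 → Ω → (Fin d → ℤ) × S} {t : ℝ≥0} (h : Measurable (ξ t)) :
    Measurable (rescaled ξ t) := by
  have h1 : Measurable fun x : Fin d → ℤ =>
      (WithLp.toLp 2 fun i => (x i : ℝ) / √(t : ℝ) : EuclideanSpace ℝ (Fin d)) :=
    measurable_of_countable _
  exact (h1.comp (measurable_fst.comp h)).prodMk (measurable_snd.comp h)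

theorem corollary2 {d : ℕ} {Ω : Type*} [MeasurableSpace Ω]
    (lam : ℝ) (hlam : 0 < lam)
    (P : (Fin d → ℤ) → Kernel UnitAddCircle UnitAddCircle) (hP0 : P 0 = 0)
    [IsMarkovKernel (Kernel.sum P)]
    (hmom : HasFiniteMoments P)
    (hgap : HasSpectralGap (Kernel.sum P))
    (ρ : Measure UnitAddCircle) [IsProbabilityMeasure ρ]
    (hρ : (Kernel.sum P).Invariant ρ)
    (hdrift : ∀ l : Fin d, ∫ u, momentOne P l (fun _ => 1) u ∂ρ = 0)
    (hσ : (asymptoticCov P ρ).PosDef)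
    (μ : Measure Ω) [IsProbabilityMeasure μ]
    (ξ : ℝ≥0 → Ω → (Fin d → ℤ) × UnitAddCircle)
    (hξ : IsRWwIS lam P ξ μ) :
    TendstoInDistribution (fun (t : ℝ≥0) (ω : Ω) => rescaled ξ t ω) atTop
      (id : EuclideanSpace ℝ (Fin d) × UnitAddCircle →
        EuclideanSpace ℝ (Fin d) × UnitAddCircle)
      (fun _ => μ)
      ((multivariateGaussian 0 (lam • asymptoticCov P ρ)).prod ρ) := by
  obtain ⟨⟨p, hp, hrates, hmarkov⟩, -⟩ := hξ
  have := hp.isMarkovKernel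
  have hT := hrates.hasJumpKernel hP0
  have hmeas : ∀ t, Measurable (rescaled ξ t) := fun t =>
    measurable_rescaled (hmarkov.measurable t)
  have : IsProbabilityMeasure (μ.map (ξ 0)) :=
    Measure.isProbabilityMeasure_map (hmarkov.measurable 0).aemeasurable
  refine ⟨fun t => (hmeas t).aemeasurable, aemeasurable_id, ?_⟩
  -- Sequences suffice because `atTop` on `ℝ≥0` is countably generated.
  refine tendsto_of_seq_tendsto fun u hu => tendsto_of_tendsto_integral_exp_mul fun θ g => ?_
  have hu' : Tendsto (fun n => (u n : ℝ)) atTop atTop := NNReal.tendsto_coe_atTop.2 hu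
  obtain ⟨C, hC⟩ := isCompact_univ.exists_bound_of_continuousOn g.continuous.continuousOn
  let G : BddMeas UnitAddCircle := BddMeas.ofBound g g.continuous.measurable C
    fun v => hC v (Set.mem_univ v)
  have hquad : 0 ≤ dotProduct (θ : Fin d → ℝ) ((asymptoticCov P ρ).mulVec θ) := by
    simpa using hσ.posSemidef.dotProduct_mulVec_nonneg θ
  -- Duality: the law at time `u n` is the initial law transported by `p (u n)`, so the semigroup
  -- can act on the test function instead.
  have hlhs : ∀ n, ∫ z, Complex.exp (inner ℝ z.1 θ * Complex.I) * g z.2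
      ∂(μ.map (rescaled ξ (u n))) = ∫ z, stepSemigroup lam (kernelOp (stepKernel P)) (u n)
        (planeWave θ (1 / √(u n : ℝ)) G) z ∂(μ.map (ξ 0)) := by
    intro n
    rw [← hT.kernelOp_eq_exp hlam.le hp (u n), ← integral_bind_kernel, ← hmarkov.map_eq_bind,
      integral_map (hmeas _).aemeasurable (Measurable.aestronglyMeasurable (by fun_prop)),
      integral_map (hmarkov.measurable _).aemeasurable
        (BddMeas.measurable _).aestronglyMeasurable]
    refine integral_congr_ae (ae_of_all _ fun ω => ?_)
    have h1 : inner ℝ (rescaled ξ (u n) ω).1 θ =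
        1 / √(u n : ℝ) * displacement θ (ξ (u n) ω).1 := by
      simp only [rescaled, displacement, PiLp.inner_apply, Finset.mul_sum]
      refine Finset.sum_congr rfl fun i _ => ?_
      simp
      ring
    change _ = Complex.exp (Complex.I * _) * g (ξ (u n) ω).2
    simp only [h1]
    rw [mul_comm Complex.I]
    rfl
  have hrhs : ∫ z, Complex.exp (inner ℝ z.1 θ * Complex.I) * g z.2
      ∂((multivariateGaussian 0 (lam • asymptoticCov P ρ)).prod ρ) = (∫ v, G v ∂ρ) *
        Real.exp (-(lam * dotProduct (θ : Fin d → ℝ) ((asymptoticCov P ρ).mulVec θ) / 2)) := by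
    rw [integral_prod_mul (fun x => Complex.exp (inner ℝ x θ * Complex.I)) g, ← charFun_apply,
      charFun_multivariateGaussian (hσ.posSemidef.smul hlam.le), mul_comm]
    congr 1
    simp [Matrix.smul_mulVec]
  change Tendsto (fun n => ∫ z, Complex.exp (inner ℝ z.1 θ * Complex.I) * g z.2
    ∂(μ.map (rescaled ξ (u n)))) atTop (𝓝 (∫ z, Complex.exp (inner ℝ z.1 θ * Complex.I) * g z.2
    ∂(((multivariateGaussian 0 (lam • asymptoticCov P ρ)).prod ρ).map id)))
  rw [Measure.map_id, hrhs]
  simp_rw [hlhs]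
  have hlim : ∀ z, Tendsto (fun n => stepSemigroup lam (kernelOp (stepKernel P)) (u n)
      (planeWave θ (1 / √(u n : ℝ)) G) z) atTop (𝓝 ((∫ v, G v ∂ρ) *
        Real.exp (-(lam * dotProduct (θ : Fin d → ℝ) ((asymptoticCov P ρ).mulVec θ) / 2)))) :=
    fun z => (tendsto_stepSemigroup_planeWave hlam hmom hgap hρ hdrift θ hquad G z).comp hu'
  -- The limit does not depend on the starting state, and contractivity bounds the integrands by
  -- ‖G‖; hence the initial law may be arbitrary.
  have := tendsto_integral_of_dominated_convergence (μ := μ.map (ξ 0)) (fun _ => ‖G‖)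
    (fun n => (BddMeas.measurable _).aestronglyMeasurable) (integrable_const _)
    (fun n => ae_of_all _ fun z => (BddMeas.norm_le _ z).trans
      ((norm_stepSemigroup_planeWave_le (P := P) hlam.le (u n).coe_nonneg _).trans
        (norm_planeWave_le θ _ G)))
    (ae_of_all _ hlim)
  simpa using this
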